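/- **Setting.** A Lie groupoid $\mathcal G\rightrightarrows B$ has smooth source and target submersions $\alpha,\beta:\mathcal G\to B$, smooth units $\varepsilon:B\to\mathcal G$, smooth inversion, and a smooth associative product $gg'$ defined when $\beta(g)=\alpha(g')$, with $\alpha(gg')=\alpha(g)$, $\beta(gg')=\beta(g')$. Put $A_b\mathcal G=\ker T_{\varepsilon(b)}\alpha$, the fibre at $b$ of the Lie algebroid $A\mathcal G$. For $X\in A_b\mathcal G$, tangent at $t=0$ to a curve $x_t$ in $\alpha^{-1}(b)$ with $x_0=\varepsilon(b)$, put $$\overleftarrow X(g)=\tfrac{d}{dt}\Big|_{0}\,g\,x_t\quad(\beta(g)=b),\qquad \overrightarrow X(g)=-\tfrac{d}{dt}\Big|_{0}\,x_t^{-1}g\quad(\alpha(g)=b).$$ A smooth function $L:\mathcal G\to\mathbb R$ satisfies the discrete Euler--Lagrange equations at a pair $(g_k,g_{k+1})$ with $\beta(g_k)=\alpha(g_{k+1})=b$ if $\overleftarrow{U}(g_k)(L)-\overrightarrow{U}(g_{k+1})(L)=0$ for every smooth section $U$ of $A\mathcal G$, where the value of $U$ at $b$ is used. A matched pair $(\mathcal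 G,\mathcal H)$ consists of Lie groupoids over the same base $B$ and smooth maps $(h,g)\mapsto h\triangleright g\in\mathcal G$, $(h,g)\mapsto h\triangleleft g\in\mathcal H$, defined for $\beta(h)=\alpha(g)$, which are a left action of $\mathcal H$ and a right action of $\mathcal G$, $$(h'h)\triangleright g=h'\triangleright(h\triangleright g),\quad \varepsilon(\alpha(g))\triangleright g=g,\quad h\triangleleft(g'g)=(h\triangleleft g')\triangleleft g,\quad h\triangleleft\varepsilon(\beta(h))=h,$$ with $\alpha(h\triangleright g)=\alpha(h)$ and $\beta(h\triangleleft g)=\beta(g)$, and which satisfy $$\beta(h\triangleright g)=\alpha(h\triangleleft g),\quad h\triangleright(g'g)=(h\triangleright g')\big((h\triangleleft g')\triangleright g\big),\quad (h'h)\triangleleft g=\big(h'\triangleleft(h\triangleright g)\big)(h\triangleleft g).$$ The matched pair Lie groupoid is the submanifold $\mathcal G\bowtie\mathcal H=\{(g,h)\in\mathcal G\times\mathcal H:\beta(g)=\alpha(h)\}$, with source $\alpha(g)$, target $\beta(h)$, units $(\varepsilon(b),\varepsilon(b))$, product $(g,h)(g',h')=\big(g(h\triangleright g'),(h\triangleleft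 g')h'\big)$ and inverse $(g,h)^{-1}=(h^{-1}\triangleright g^{-1},h^{-1}\triangleleft g^{-1})$. For $X\in A_b\mathcal G$ and $Y\in A_b\mathcal H$, tangent to $x_t$ and $y_t$, and for $\beta(h)=b=\alpha(g)$, put $$h\triangleright X=\tfrac{d}{dt}\Big|_0 h\triangleright x_t\in A_{\alpha(h)}\mathcal G,\qquad X^\dagger(h)=\tfrac{d}{dt}\Big|_0 h\triangleleft x_t\in T_h\mathcal H,$$ $$Y^\dagger(g)=\tfrac{d}{dt}\Big|_0 y_t^{-1}\triangleright g\in T_g\mathcal G,\qquad Y\triangleleft g=\tfrac{d}{dt}\Big|_0 (y_t^{-1}\triangleleft g)^{-1}\in A_{\beta(g)}\mathcal H.$$ Pairs $(X,Y)\in A_b\mathcal G\times A_b\mathcal H$ correspond to elements $U=(X,\,T(\varepsilon_{\mathcal H}\circ\beta)X+Y)$ of $A_b(\mathcal G\bowtie\mathcal H)$. **Proposition.** Let $(\mathcal G,\mathcal H)$ be a matched pair of Lie groupoids, let $L:\mathcal G\bowtie\mathcal H\to\mathbb R$ be smooth, and let $(g_k,h_k),(g_{k+1},h_{k+1})\in\mathcal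 G\bowtie\mathcal H$ be composable, i.e. $\beta(h_k)=b=\alpha(g_{k+1})$. Then $L$ has smooth extensions to neighbourhoods of $(g_k,h_k)$ and of $(g_{k+1},h_{k+1})$ in $\mathcal G\times\mathcal H$. Choose any such extensions, and for $v\in T\mathcal G$ and $w\in T\mathcal H$ at these points let $v(L)$ and $w(L)$ be the derivatives of the extension along $(v,0)$ and $(0,w)$. Put $$\mathcal E(X,Y)=\overleftarrow{h_k\triangleright X}(g_k)(L)-\overrightarrow{X}(g_{k+1})(L)+Y^\dagger(g_{k+1})(L)+X^\dagger(h_k)(L)+\overleftarrow{Y}(h_k)(L)-\overrightarrow{Y\triangleleft g_{k+1}}(h_{k+1})(L).$$ 1. For all $X\in A_b\mathcal G$ and $Y\in A_b\mathcal H$, with corresponding $U\in A_b(\mathcal G\bowtie\mathcal H)$, $$\overleftarrow{U}(g_k,h_k)(L)-\overrightarrow{U}(g_{k+1},h_{k+1})(L)=\mathcal E(X,Y).$$ 2. $L$ satisfies the discrete Euler--Lagrange equations on $\mathcal G\bowtie\mathcal H$ at $\big((g_k,h_k),(g_{k+1},h_{k+1})\big)$ if and only if $\mathcal E(X,Y)=0$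 for all smooth sections $X$ of $A\mathcal G$ and $Y$ of $A\mathcal H$, evaluated at $b$. -/

import Mathlib

set_option linter.unusedSectionVars false

open Set Manifold
open scoped Manifold ContDiff Topology

noncomputable section

section FiberProduct

variable {EM EN EB M N B : Type*}
  [NormedAddCommGroup EM] [NormedSpace ℝ EM] [NormedAddCommGroup EN] [NormedSpace ℝ EN]
  [NormedAddCommGroup EB] [NormedSpace ℝ EB]
  [TopologicalSpace M] [ChartedSpace EM M] [TopologicalSpace N] [ChartedSpace EN N]
  [TopologicalSpace B] [ChartedSpace EB B]
  {f : M → B} {g : N → B}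

/-- The fibre product `M ×_B N = {(m, n) | f m = g n}` of a smooth map `f` and a submersion `g`.
It is given below its structure of an embedded submanifold of `M × N`. -/
@[ext]
structure FiberProduct (hf : ContMDiff 𝓘(ℝ, EM) 𝓘(ℝ, EB) ∞ f)
    (hg : IsSubmersion 𝓘(ℝ, EN) 𝓘(ℝ, EB) ∞ g) where
  fst : M
  snd : N
  condition : f fst = g snd

namespace FiberProduct

variable {hf : ContMDiff 𝓘(ℝ, EM) 𝓘(ℝ, EB) ∞ f} {hg : IsSubmersion 𝓘(ℝ, EN) 𝓘(ℝ, EB) ∞ g}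

/-- The inclusion into `M × N`. -/
def incl (p : FiberProduct hf hg) : M × N := (p.fst, p.snd)

/-- The subspace topology. -/
instance : TopologicalSpace (FiberProduct hf hg) := TopologicalSpace.induced incl inferInstance

theorem continuous_incl : Continuous (incl : FiberProduct hf hg → M × N) := continuous_induced_dom

theorem continuous_fst : Continuous (fst : FiberProduct hf hg → M) :=
  _root_.continuous_fst.comp continuous_incl

theorem continuous_snd : Continuous (snd : FiberProduct hf hg → N) :=
  _root_.continuous_snd.comp continuous_incl

/-- Charts in which `g` is a linear projection, around a point of `N`. -/
def dom (hg : IsSubmersion 𝓘(ℝ, EN) 𝓘(ℝ, EB) ∞ g) (n : N) : OpenPartialHomeomorph N EN :=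
  (hg.isSubmersionOfComplement_complement n).domChart

def cod (hg : IsSubmersion 𝓘(ℝ, EN) 𝓘(ℝ, EB) ∞ g) (n : N) : OpenPartialHomeomorph B EB :=
  (hg.isSubmersionOfComplement_complement n).codChart

def lin (hg : IsSubmersion 𝓘(ℝ, EN) 𝓘(ℝ, EB) ∞ g) (n : N) : EN ≃L[ℝ] EB × hg.complement :=
  (hg.isSubmersionOfComplement_complement n).equiv

theorem mem_dom (hg : IsSubmersion 𝓘(ℝ, EN) 𝓘(ℝ, EB) ∞ g) (n : N) : n ∈ (dom hg n).source :=
  (hg.isSubmersionOfComplement_complement n).mem_domChart_source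

theorem dom_mem (hg : IsSubmersion 𝓘(ℝ, EN) 𝓘(ℝ, EB) ∞ g) (n : N) :
    dom hg n ∈ IsManifold.maximalAtlas 𝓘(ℝ, EN) ∞ N :=
  (hg.isSubmersionOfComplement_complement n).domChart_mem_maximalAtlas

theorem cod_mem (hg : IsSubmersion 𝓘(ℝ, EN) 𝓘(ℝ, EB) ∞ g) (n : N) :
    cod hg n ∈ IsManifold.maximalAtlas 𝓘(ℝ, EB) ∞ B :=
  (hg.isSubmersionOfComplement_complement n).codChart_mem_maximalAtlas

theorem map_dom (hg : IsSubmersion 𝓘(ℝ, EN) 𝓘(ℝ, EB) ∞ g) (n : N) {n' : N}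
    (h : n' ∈ (dom hg n).source) : g n' ∈ (cod hg n).source :=
  (hg.isSubmersionOfComplement_complement n).source_subset_preimage_source h

theorem written (hg : IsSubmersion 𝓘(ℝ, EN) 𝓘(ℝ, EB) ∞ g) (n : N) {n' : N}
    (h : n' ∈ (dom hg n).source) : cod hg n (g n') = (lin hg n (dom hg n n')).1 := by
  have h0 : dom hg n n' ∈ ((dom hg n).extend 𝓘(ℝ, EN)).target := by
    simpa using (dom hg n).map_source h
  have h1 := (hg.isSubmersionOfComplement_complement n).writtenInCharts h0
  simp only [Function.comp_apply] at h1
  change (cod hg n) (g ((dom hg n).symm (dom hg n n'))) = _ at h1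
  rwa [(dom hg n).left_inv h] at h1

/-- The local parametrisation of the fibre product, as a map into `M × N`. -/
def param (hg : IsSubmersion 𝓘(ℝ, EN) 𝓘(ℝ, EB) ∞ g) (f : M → B)
    (c : OpenPartialHomeomorph M EM) (n : N) (x : EM × hg.complement) : M × N :=
  (c.symm x.1, (dom hg n).symm ((lin hg n).symm (cod hg n (f (c.symm x.1)), x.2)))

/-- The local coordinates of the fibre product, as a map defined on `M × N`. -/
def coord (hg : IsSubmersion 𝓘(ℝ, EN) 𝓘(ℝ, EB) ∞ g)
    (c : OpenPartialHomeomorph M EM) (n : N) (p : M × N) : EM × hg.complement :=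
  (c p.1, (lin hg n (dom hg n p.2)).2)

def chartTarget (hg : IsSubmersion 𝓘(ℝ, EN) 𝓘(ℝ, EB) ∞ g) (f : M → B)
    (c : OpenPartialHomeomorph M EM) (n : N) : Set (EM × hg.complement) :=
  {x | x.1 ∈ c.target ∧ f (c.symm x.1) ∈ (cod hg n).source ∧
    (lin hg n).symm (cod hg n (f (c.symm x.1)), x.2) ∈ (dom hg n).target}

theorem param_condition {c : OpenPartialHomeomorph M EM} {n : N} {x : EM × hg.complement}
    (hx : x ∈ chartTarget hg f c n) : f (param hg f c n x).1 = g (param hg f c n x).2 := by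
  obtain ⟨h1, h2, h3⟩ := hx
  have h4 := (dom hg n).map_target h3
  refine (cod hg n).injOn h2 (map_dom hg n h4) ?_
  simp only [param]
  rw [written hg n h4, (dom hg n).right_inv h3]
  simp

theorem coord_param {c : OpenPartialHomeomorph M EM} {n : N} {x : EM × hg.complement}
    (hx : x ∈ chartTarget hg f c n) : coord hg c n (param hg f c n x) = x := by
  obtain ⟨h1, h2, h3⟩ := hx
  simp [coord, param, (dom hg n).right_inv h3, c.right_inv h1]

theorem param_coord {c : OpenPartialHomeomorph M EM} {n : N} (p : FiberProduct hf hg)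
    (h1 : p.fst ∈ c.source) (h2 : p.snd ∈ (dom hg n).source) :
    param hg f c n (coord hg c n p.incl) = p.incl := by
  have h3 := written hg n h2
  rw [← p.condition] at h3
  simp [coord, param, incl, c.left_inv h1, h3, (dom hg n).left_inv h2]

theorem continuousOn_param (hf : Continuous f) (c : OpenPartialHomeomorph M EM) (n : N) :
    ContinuousOn (param hg f c n) (chartTarget hg f c n) := by
  have h1 : ContinuousOn (fun x : EM × hg.complement => c.symm x.1) (chartTarget hg f c n) :=
    c.continuousOn_symm.comp continuousOn_fst fun x hx => hx.1
  refine h1.prodMk ?_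
  refine (dom hg n).continuousOn_symm.comp ?_ fun x hx => hx.2.2
  refine (lin hg n).symm.continuous.comp_continuousOn (ContinuousOn.prodMk ?_ continuousOn_snd)
  exact (cod hg n).continuousOn.comp (hf.comp_continuousOn h1) fun x hx => hx.2.1

theorem isOpen_chartTarget (hf : Continuous f) (c : OpenPartialHomeomorph M EM) (n : N) :
    IsOpen (chartTarget hg f c n) := by
  have o1 : IsOpen {x : EM × hg.complement | x.1 ∈ c.target} :=
    c.open_target.preimage _root_.continuous_fst
  have h1 : ContinuousOn (fun x : EM × hg.complement => f (c.symm x.1)) {x | x.1 ∈ c.target} :=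
    hf.comp_continuousOn (c.continuousOn_symm.comp continuousOn_fst fun x hx => hx)
  have o2 := h1.isOpen_inter_preimage o1 (cod hg n).open_source
  have h2 : ContinuousOn (fun x : EM × hg.complement =>
      (lin hg n).symm (cod hg n (f (c.symm x.1)), x.2))
      ({x | x.1 ∈ c.target} ∩ (fun x => f (c.symm x.1)) ⁻¹' (cod hg n).source) :=
    (lin hg n).symm.continuous.comp_continuousOn
      (((cod hg n).continuousOn.comp (h1.mono inter_subset_left) fun x hx => hx.2).prodMk
        continuousOn_snd)
  convert! h2.isOpen_inter_preimage o2 (dom hg n).open_target using 1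
  ext x
  simp [chartTarget, and_assoc]

theorem coord_mem {c : OpenPartialHomeomorph M EM} {n : N} (p : FiberProduct hf hg)
    (h1 : p.fst ∈ c.source) (h2 : p.snd ∈ (dom hg n).source) :
    coord hg c n p.incl ∈ chartTarget hg f c n := by
  have h3 := written hg n h2
  rw [← p.condition] at h3
  refine ⟨c.map_source h1, ?_, ?_⟩
  · simp only [coord, incl, c.left_inv h1, p.condition]
    exact map_dom hg _ h2
  · simp only [coord, incl, c.left_inv h1, h3, Prod.mk.eta,
      ContinuousLinearEquiv.symm_apply_apply]
    exact (dom hg n).map_source h2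

open Classical in
/-- The inverse of the chart below, with the value `p₀` outside of its domain. -/
def ofParam (p₀ : FiberProduct hf hg) (c : OpenPartialHomeomorph M EM) (x : EM × hg.complement) :
    FiberProduct hf hg :=
  if hx : x ∈ chartTarget hg f c p₀.snd then
    ⟨(param hg f c p₀.snd x).1, (param hg f c p₀.snd x).2, param_condition hx⟩
  else p₀

theorem incl_ofParam (p₀ : FiberProduct hf hg) (c : OpenPartialHomeomorph M EM)
    {x : EM × hg.complement} (hx : x ∈ chartTarget hg f c p₀.snd) :
    (ofParam p₀ c x).incl = param hg f c p₀.snd x := by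
  rw [ofParam, dif_pos hx]; rfl

theorem incl_injective : Function.Injective (incl : FiberProduct hf hg → M × N) :=
  fun _ _ h => FiberProduct.ext (congrArg Prod.fst h) (congrArg Prod.snd h)

/-- The chart of the fibre product built from a chart `c` of `M` and the normal form of `g` near
the second component of `p₀`. -/
def chart (p₀ : FiberProduct hf hg) (c : OpenPartialHomeomorph M EM) :
    OpenPartialHomeomorph (FiberProduct hf hg) (EM × hg.complement) where
  toFun p := coord hg c p₀.snd p.incl
  invFun := ofParam p₀ c
  source := {p | p.fst ∈ c.source ∧ p.snd ∈ (dom hg p₀.snd).source}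
  target := chartTarget hg f c p₀.snd
  map_source' p hp := coord_mem p hp.1 hp.2
  map_target' x hx := by
    have h := incl_ofParam p₀ c hx
    have h1 : (ofParam p₀ c x).fst = c.symm x.1 := congrArg Prod.fst h
    have h2 : (ofParam p₀ c x).snd = (param hg f c p₀.snd x).2 := congrArg Prod.snd h
    exact ⟨h1 ▸ c.map_target hx.1, h2 ▸ (dom hg p₀.snd).map_target hx.2.2⟩
  left_inv' p hp :=
    incl_injective ((incl_ofParam p₀ c (coord_mem p hp.1 hp.2)).trans (param_coord p hp.1 hp.2))
  right_inv' x hx := by rw [incl_ofParam p₀ c hx, coord_param hx]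
  open_source := (c.open_source.preimage continuous_fst).inter
    ((dom hg p₀.snd).open_source.preimage continuous_snd)
  open_target := isOpen_chartTarget hf.continuous c p₀.snd
  continuousOn_toFun := by
    refine ContinuousOn.prodMk (c.continuousOn.comp continuous_fst.continuousOn fun p hp => hp.1) ?_
    exact _root_.continuous_snd.comp_continuousOn
      ((lin hg p₀.snd).continuous.comp_continuousOn
        ((dom hg p₀.snd).continuousOn.comp continuous_snd.continuousOn fun p hp => hp.2))
  continuousOn_invFun := by
    rw [(⟨rfl⟩ : Topology.IsInducing (incl : FiberProduct hf hg → M × N)).continuousOn_iff]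
    exact (continuousOn_param hf.continuous c p₀.snd).congr fun x hx => incl_ofParam p₀ c hx

instance : ChartedSpace (EM × hg.complement) (FiberProduct hf hg) where
  atlas := range fun p => chart p (chartAt EM p.fst)
  chartAt p := chart p (chartAt EM p.fst)
  mem_chart_source p := ⟨mem_chart_source EM p.fst, mem_dom hg p.snd⟩
  chart_mem_atlas p := mem_range_self p

/-! Smoothness -/

section Smooth

theorem chart_apply (p₀ p : FiberProduct hf hg) (c : OpenPartialHomeomorph M EM) :
    chart p₀ c p = coord hg c p₀.snd p.incl := rfl

theorem contMDiffOn_coord {c : OpenPartialHomeomorph M EM}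
    (hc : c ∈ IsManifold.maximalAtlas 𝓘(ℝ, EM) ∞ M) (n : N) :
    ContMDiffOn (𝓘(ℝ, EM).prod 𝓘(ℝ, EN)) 𝓘(ℝ, EM × hg.complement) ∞ (coord hg c n)
      {p | p.1 ∈ c.source ∧ p.2 ∈ (dom hg n).source} := by
  refine ContMDiffOn.prodMk_space
    ((contMDiffOn_of_mem_maximalAtlas hc).comp contMDiffOn_fst fun p hp => hp.1) ?_
  have h1 : ContMDiffOn (𝓘(ℝ, EM).prod 𝓘(ℝ, EN)) 𝓘(ℝ, EN) ∞ (fun p : M × N => dom hg n p.2)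
      {p | p.1 ∈ c.source ∧ p.2 ∈ (dom hg n).source} :=
    (contMDiffOn_of_mem_maximalAtlas (dom_mem hg n)).comp contMDiffOn_snd fun p hp => hp.2
  have h2 : ContMDiff 𝓘(ℝ, EN) 𝓘(ℝ, hg.complement) ∞ (fun x : EN => (lin hg n x).2) :=
    ((ContinuousLinearMap.snd ℝ EB hg.complement).comp
      (lin hg n : EN →L[ℝ] EB × hg.complement)).contMDiff
  exact h2.comp_contMDiffOn h1

theorem contMDiffOn_param (hf : ContMDiff 𝓘(ℝ, EM) 𝓘(ℝ, EB) ∞ f) {c : OpenPartialHomeomorph M EM}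
    (hc : c ∈ IsManifold.maximalAtlas 𝓘(ℝ, EM) ∞ M) (n : N) :
    ContMDiffOn 𝓘(ℝ, EM × hg.complement) (𝓘(ℝ, EM).prod 𝓘(ℝ, EN)) ∞ (param hg f c n)
      (chartTarget hg f c n) := by
  have h1 : ContMDiffOn 𝓘(ℝ, EM × hg.complement) 𝓘(ℝ, EM) ∞
      (fun x : EM × hg.complement => c.symm x.1) (chartTarget hg f c n) :=
    (contMDiffOn_symm_of_mem_maximalAtlas hc).comp
      (ContinuousLinearMap.fst ℝ EM hg.complement).contMDiff.contMDiffOn fun x hx => hx.1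
  refine h1.prodMk ?_
  refine (contMDiffOn_symm_of_mem_maximalAtlas (dom_mem hg n)).comp ?_ fun x hx => hx.2.2
  have h2 : ContMDiffOn 𝓘(ℝ, EM × hg.complement) 𝓘(ℝ, EB) ∞
      (fun x : EM × hg.complement => cod hg n (f (c.symm x.1))) (chartTarget hg f c n) :=
    (contMDiffOn_of_mem_maximalAtlas (cod_mem hg n)).comp (hf.comp_contMDiffOn h1)
      fun x hx => hx.2.1
  exact ((lin hg n).symm : EB × hg.complement →L[ℝ] EN).contMDiff.comp_contMDiffOn
    (h2.prodMk_space (ContinuousLinearMap.snd ℝ EM hg.complement).contMDiff.contMDiffOn)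

instance [IsManifold 𝓘(ℝ, EM) ∞ M] :
    IsManifold 𝓘(ℝ, EM × hg.complement) ∞ (FiberProduct hf hg) := by
  refine isManifold_of_contDiffOn _ _ _ ?_
  rintro _ _ ⟨p, rfl⟩ ⟨q, rfl⟩
  simp only [modelWithCornersSelf_coe, modelWithCornersSelf_coe_symm, Function.id_comp,
    Function.comp_id, preimage_id, range_id, inter_univ]
  rw [← contMDiffOn_iff_contDiffOn]
  have h1 := contMDiffOn_param (hg := hg) hf
    (IsManifold.chart_mem_maximalAtlas (I := 𝓘(ℝ, EM)) (n := ∞) p.fst) p.snd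
  have h2 := contMDiffOn_coord (hg := hg)
    (IsManifold.chart_mem_maximalAtlas (I := 𝓘(ℝ, EM)) (n := ∞) q.fst) q.snd
  refine (h2.comp (s := ((chart p (chartAt EM p.fst)).symm ≫ₕ
    chart q (chartAt EM q.fst)).source) (h1.mono fun x hx => hx.1) fun x hx => ?_).congr fun x hx => ?_
  · have h3 := incl_ofParam p (chartAt EM p.fst) hx.1
    have h4 : ofParam p (chartAt EM p.fst) x ∈ (chart q (chartAt EM q.fst)).source := hx.2
    rw [mem_preimage, ← h3]
    exact h4
  · change coord hg _ _ (ofParam p (chartAt EM p.fst) x).incl = _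
    rw [incl_ofParam p _ hx.1]
    rfl

variable [IsManifold 𝓘(ℝ, EM) ∞ M]

theorem contMDiff_incl : ContMDiff 𝓘(ℝ, EM × hg.complement) (𝓘(ℝ, EM).prod 𝓘(ℝ, EN)) ∞
    (incl : FiberProduct hf hg → M × N) := by
  intro p
  have hc := IsManifold.chart_mem_maximalAtlas (I := 𝓘(ℝ, EM)) (n := ∞) p.fst
  have h1 := contMDiffOn_param (hg := hg) hf hc p.snd
  have h2 : ContMDiffOn 𝓘(ℝ, EM × hg.complement) 𝓘(ℝ, EM × hg.complement) ∞
      (chart p (chartAt EM p.fst)) (chart p (chartAt EM p.fst)).source :=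
    contMDiffOn_chart (x := p)
  have h3 : p ∈ (chart p (chartAt EM p.fst)).source := mem_chart_source _ p
  refine ((h1.comp h2 fun q hq => ?_).congr fun q hq => ?_).contMDiffAt
    ((chart p (chartAt EM p.fst)).open_source.mem_nhds h3)
  · exact (chart p (chartAt EM p.fst)).map_source hq
  · exact (param_coord q hq.1 hq.2).symm

theorem contMDiff_fst : ContMDiff 𝓘(ℝ, EM × hg.complement) 𝓘(ℝ, EM) ∞
    (fst : FiberProduct hf hg → M) :=
  _root_.contMDiff_fst.comp contMDiff_incl

theorem contMDiff_snd : ContMDiff 𝓘(ℝ, EM × hg.complement) 𝓘(ℝ, EN) ∞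
    (snd : FiberProduct hf hg → N) :=
  _root_.contMDiff_snd.comp contMDiff_incl

/-- Universal property: a map into the fibre product is smooth if its composition with the
inclusion is. -/
theorem contMDiffAt_of_incl {EP HP P : Type*} [NormedAddCommGroup EP] [NormedSpace ℝ EP]
    [TopologicalSpace HP] {I : ModelWithCorners ℝ EP HP} [TopologicalSpace P] [ChartedSpace HP P]
    {u : P → FiberProduct hf hg} {x : P}
    (hu : ContMDiffAt I (𝓘(ℝ, EM).prod 𝓘(ℝ, EN)) ∞ (fun y => (u y).incl) x) :
    ContMDiffAt I 𝓘(ℝ, EM × hg.complement) ∞ u x := by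
  rw [contMDiffAt_iff_target]
  refine ⟨(⟨rfl⟩ : Topology.IsInducing (incl : FiberProduct hf hg → M × N)).continuousAt_iff.2
    hu.continuousAt, ?_⟩
  have h := contMDiffOn_coord (hg := hg)
    (IsManifold.chart_mem_maximalAtlas (I := 𝓘(ℝ, EM)) (n := ∞) (u x).fst) (u x).snd
  refine ContMDiffAt.comp (f := fun y => (u y).incl) x (h.contMDiffAt (x := (u x).incl) ?_) hu
  exact (((chartAt EM (u x).fst).open_source.preimage _root_.continuous_fst).inter
    ((dom hg (u x).snd).open_source.preimage _root_.continuous_snd)).mem_nhds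
      ⟨mem_chart_source _ _, mem_dom hg _⟩

theorem contMDiff_of_components {EP HP P : Type*} [NormedAddCommGroup EP] [NormedSpace ℝ EP]
    [TopologicalSpace HP] {I : ModelWithCorners ℝ EP HP} [TopologicalSpace P] [ChartedSpace HP P]
    {u : P → FiberProduct hf hg} (h₁ : ContMDiff I 𝓘(ℝ, EM) ∞ fun y => (u y).fst)
    (h₂ : ContMDiff I 𝓘(ℝ, EN) ∞ fun y => (u y).snd) :
    ContMDiff I 𝓘(ℝ, EM × hg.complement) ∞ u :=
  fun x => contMDiffAt_of_incl ((h₁ x).prodMk (h₂ x))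

theorem chart_mem {c : OpenPartialHomeomorph M EM}
    (hc : c ∈ IsManifold.maximalAtlas 𝓘(ℝ, EM) ∞ M) (p : FiberProduct hf hg) :
    chart p c ∈ IsManifold.maximalAtlas 𝓘(ℝ, EM × hg.complement) ∞ (FiberProduct hf hg) := by
  refine OpenPartialHomeomorph.mem_maximalAtlas_of_contMDiffOn _ ?_ ?_
  · exact (contMDiffOn_coord hc p.snd).comp contMDiff_incl.contMDiffOn fun q hq => hq
  · intro x hx
    have h := (contMDiffOn_param (hg := hg) hf hc p.snd).contMDiffAt
      ((isOpen_chartTarget hf.continuous c p.snd).mem_nhds hx)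
    refine (contMDiffAt_of_incl (u := (chart p c).symm) (h.congr_of_eventuallyEq ?_)
      ).contMDiffWithinAt
    filter_upwards [(isOpen_chartTarget hf.continuous c p.snd).mem_nhds hx] with y hy
    exact incl_ofParam p c hy

/-! Tangent vectors -/

/-- A tangent vector of the fibre product is determined by its two components. -/
theorem tangent_ext (p : FiberProduct hf hg) {u u' : TangentSpace 𝓘(ℝ, EM × hg.complement) p}
    (h : mfderiv 𝓘(ℝ, EM × hg.complement) (𝓘(ℝ, EM).prod 𝓘(ℝ, EN)) incl p u =
      mfderiv 𝓘(ℝ, EM × hg.complement) (𝓘(ℝ, EM).prod 𝓘(ℝ, EN)) incl p u') : u = u' := by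
  have hc := IsManifold.chart_mem_maximalAtlas (I := 𝓘(ℝ, EM)) (n := ∞) p.fst
  have hn : {q : M × N | q.1 ∈ (chartAt EM p.fst).source ∧ q.2 ∈ (dom hg p.snd).source} ∈
      𝓝 p.incl :=
    (((chartAt EM p.fst).open_source.preimage _root_.continuous_fst).inter
      ((dom hg p.snd).open_source.preimage _root_.continuous_snd)).mem_nhds
      ⟨mem_chart_source _ _, mem_dom hg _⟩
  have h1 := ((contMDiffOn_coord hc p.snd).contMDiffAt hn).mdifferentiableAt (by simp)
  have h2 := mfderiv_comp p h1 (contMDiff_incl.contMDiffAt.mdifferentiableAt (by simp))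
  have h3 := (mdifferentiable_chart (I := 𝓘(ℝ, EM × hg.complement)) p).mfderiv_injective
    (mem_chart_source _ p)
  apply h3
  change (mfderiv 𝓘(ℝ, EM × hg.complement) 𝓘(ℝ, EM × hg.complement)
    (coord hg (chartAt EM p.fst) p.snd ∘ incl) p) u = (mfderiv 𝓘(ℝ, EM × hg.complement)
    𝓘(ℝ, EM × hg.complement) (coord hg (chartAt EM p.fst) p.snd ∘ incl) p) u'
  rw [h2]
  exact congrArg (mfderiv (𝓘(ℝ, EM).prod 𝓘(ℝ, EN)) 𝓘(ℝ, EM × hg.complement)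
    (coord hg (chartAt EM p.fst) p.snd) p.incl) h

/-- The tangent space of the fibre product at `p` consists of the pairs `(v, w)` of tangent vectors
with `Tf v = Tg w`. -/
theorem exists_tangent (p : FiberProduct hf hg) (v : TangentSpace 𝓘(ℝ, EM) p.fst)
    (w : TangentSpace 𝓘(ℝ, EN) p.snd)
    (h : (mfderiv 𝓘(ℝ, EM) 𝓘(ℝ, EB) f p.fst v : EB) = mfderiv 𝓘(ℝ, EN) 𝓘(ℝ, EB) g p.snd w) :
    ∃ u : TangentSpace 𝓘(ℝ, EM × hg.complement) p,
      mfderiv 𝓘(ℝ, EM × hg.complement) (𝓘(ℝ, EM).prod 𝓘(ℝ, EN)) incl p u = (v, w) := by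
  have hc := IsManifold.chart_mem_maximalAtlas (I := 𝓘(ℝ, EM)) (n := ∞) p.fst
  set c := chartAt EM p.fst with hcdef
  set d := dom hg p.snd with hd
  set e := lin hg p.snd with he
  set ψ := cod hg p.snd with hψ
  have hcm : p.fst ∈ c.source := mem_chart_source _ _
  have hdm : p.snd ∈ d.source := mem_dom hg p.snd
  have hψm : g p.snd ∈ ψ.source := map_dom hg _ hdm
  have hψm' : f p.fst ∈ ψ.source := p.condition ▸ hψm
  have hn : {q : M × N | q.1 ∈ c.source ∧ q.2 ∈ d.source} ∈ 𝓝 p.incl :=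
    ((c.open_source.preimage _root_.continuous_fst).inter
      (d.open_source.preimage _root_.continuous_snd)).mem_nhds ⟨hcm, hdm⟩
  have hcoord := ((contMDiffOn_coord (hg := hg) hc p.snd).contMDiffAt hn).mdifferentiableAt
    (by simp)
  have hx0 := coord_mem p hcm hdm
  have hparam := ((contMDiffOn_param (hg := hg) hf hc p.snd).contMDiffAt
    ((isOpen_chartTarget hf.continuous c p.snd).mem_nhds hx0)).mdifferentiableAt (by simp)
  have hincl : MDifferentiableAt 𝓘(ℝ, EM × hg.complement) (𝓘(ℝ, EM).prod 𝓘(ℝ, EN))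
      (incl : FiberProduct hf hg → M × N) p := contMDiff_incl.contMDiffAt.mdifferentiableAt (by simp)
  -- the vector `u`
  obtain ⟨u, hu⟩ := (mdifferentiable_chart (I := 𝓘(ℝ, EM × hg.complement)) p).mfderiv_surjective
    (mem_chart_source _ p) (mfderiv (𝓘(ℝ, EM).prod 𝓘(ℝ, EN)) 𝓘(ℝ, EM × hg.complement)
      (coord hg c p.snd) p.incl (v, w))
  refine ⟨u, ?_⟩
  have hu' : mfderiv (𝓘(ℝ, EM).prod 𝓘(ℝ, EN)) 𝓘(ℝ, EM × hg.complement) (coord hg c p.snd) p.incl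
      (mfderiv 𝓘(ℝ, EM × hg.complement) (𝓘(ℝ, EM).prod 𝓘(ℝ, EN)) incl p u) =
      mfderiv (𝓘(ℝ, EM).prod 𝓘(ℝ, EN)) 𝓘(ℝ, EM × hg.complement) (coord hg c p.snd) p.incl (v, w) := by
    rw [← hu]
    exact (congrArg (fun T => T u) (mfderiv_comp p hcoord hincl)).symm
  -- `param ∘ coord`
  let K : EB × N → N := fun y => d.symm (e.symm (y.1, (e (d y.2)).2))
  let A : M × N → EB × N := fun q => (ψ (f q.1), q.2)
  let G : N → EB × N := fun n => (ψ (g n), n)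
  have hAp : A p.incl = G p.snd := by simp only [A, G, incl, p.condition]
  have hKG : ∀ n ∈ d.source, K (G n) = n := by
    intro n hn
    have h1 : ψ (g n) = (e (d n)).1 := written hg p.snd hn
    change d.symm (e.symm (ψ (g n), (e (d n)).2)) = n
    rw [h1, Prod.mk.eta, e.symm_apply_apply, d.left_inv hn]
  have hψs : MDifferentiableAt 𝓘(ℝ, EB) 𝓘(ℝ, EB) ψ (g p.snd) :=
    (contMDiffAt_of_mem_maximalAtlas (cod_mem hg p.snd) hψm).mdifferentiableAt (by simp)
  have hψs' : MDifferentiableAt 𝓘(ℝ, EB) 𝓘(ℝ, EB) ψ (f p.fst) :=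
    (contMDiffAt_of_mem_maximalAtlas (cod_mem hg p.snd) hψm').mdifferentiableAt (by simp)
  have hgs : MDifferentiableAt 𝓘(ℝ, EN) 𝓘(ℝ, EB) g p.snd :=
    hg.contMDiff.contMDiffAt.mdifferentiableAt (by simp)
  have hfs : MDifferentiableAt 𝓘(ℝ, EM) 𝓘(ℝ, EB) f p.fst :=
    hf.contMDiffAt.mdifferentiableAt (by simp)
  have hds : MDifferentiableAt 𝓘(ℝ, EN) 𝓘(ℝ, EN) d p.snd :=
    (contMDiffAt_of_mem_maximalAtlas (dom_mem hg p.snd) hdm).mdifferentiableAt (by simp)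
  have hds' : MDifferentiableAt 𝓘(ℝ, EN) 𝓘(ℝ, EN) d.symm (d p.snd) :=
    (contMDiffAt_symm_of_mem_maximalAtlas (dom_mem hg p.snd) (d.map_source hdm)).mdifferentiableAt
      (by simp)
  have hG : MDifferentiableAt 𝓘(ℝ, EN) (𝓘(ℝ, EB).prod 𝓘(ℝ, EN)) G p.snd :=
    (hψs.comp p.snd hgs).prodMk mdifferentiableAt_id
  have hψf : MDifferentiableAt (𝓘(ℝ, EM).prod 𝓘(ℝ, EN)) 𝓘(ℝ, EB) (fun q : M × N => ψ (f q.1))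
      p.incl :=
    MDifferentiableAt.comp (f := fun q : M × N => f q.1) p.incl hψs'
      (MDifferentiableAt.comp (f := Prod.fst) p.incl hfs mdifferentiableAt_fst)
  have hA : MDifferentiableAt (𝓘(ℝ, EM).prod 𝓘(ℝ, EN)) (𝓘(ℝ, EB).prod 𝓘(ℝ, EN)) A p.incl :=
    hψf.prodMk mdifferentiableAt_snd
  have hK : MDifferentiableAt (𝓘(ℝ, EB).prod 𝓘(ℝ, EN)) 𝓘(ℝ, EN) K (G p.snd) := by
    have h1 : MDifferentiableAt (𝓘(ℝ, EB).prod 𝓘(ℝ, EN)) 𝓘(ℝ, EB × hg.complement)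
        (fun y : EB × N => (y.1, (e (d y.2)).2)) (G p.snd) := by
      refine MDifferentiableAt.prodMk_space mdifferentiableAt_fst ?_
      have h2 : MDifferentiableAt 𝓘(ℝ, EN) 𝓘(ℝ, hg.complement) (fun x : EN => (e x).2) (d p.snd) :=
        ((ContinuousLinearMap.snd ℝ EB hg.complement).comp
          (e : EN →L[ℝ] EB × hg.complement)).mdifferentiableAt
      exact MDifferentiableAt.comp (f := fun y : EB × N => d y.2) (G p.snd) h2
        (MDifferentiableAt.comp (f := Prod.snd) (G p.snd) hds mdifferentiableAt_snd)
    have h3 : MDifferentiableAt (𝓘(ℝ, EB).prod 𝓘(ℝ, EN)) 𝓘(ℝ, EN)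
        (fun y : EB × N => e.symm (y.1, (e (d y.2)).2)) (G p.snd) :=
      MDifferentiableAt.comp (f := fun y : EB × N => (y.1, (e (d y.2)).2)) (G p.snd)
        (e.symm : EB × hg.complement →L[ℝ] EN).mdifferentiableAt h1
    refine MDifferentiableAt.comp (f := fun y : EB × N => e.symm (y.1, (e (d y.2)).2)) (G p.snd)
      ?_ h3
    have h4 : e.symm ((G p.snd).1, (e (d (G p.snd).2)).2) = d p.snd := by
      have h5 : ψ (g p.snd) = (e (d p.snd)).1 := written hg p.snd hdm
      change e.symm (ψ (g p.snd), (e (d p.snd)).2) = d p.snd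
      rw [h5, Prod.mk.eta, e.symm_apply_apply]
    rw [h4]
    exact hds'
  rw [← hAp] at hK
  -- `incl = param ∘ coord ∘ incl` near `p`
  have hloc : (incl : FiberProduct hf hg → M × N) =ᶠ[𝓝 p]
      (param hg f c p.snd ∘ coord hg c p.snd) ∘ incl := by
    filter_upwards [continuous_incl.continuousAt.preimage_mem_nhds hn] with q hq
    exact (param_coord q hq.1 hq.2).symm
  have hloc' : param hg f c p.snd ∘ coord hg c p.snd =ᶠ[𝓝 p.incl] fun q => (q.1, K (A q)) := by
    filter_upwards [hn] with q hq
    simp only [Function.comp_apply, param, coord, c.left_inv hq.1]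
    rfl
  have hpc := hparam.comp p.incl hcoord
  have e1 : mfderiv 𝓘(ℝ, EM × hg.complement) (𝓘(ℝ, EM).prod 𝓘(ℝ, EN)) incl p u =
      mfderiv (𝓘(ℝ, EM).prod 𝓘(ℝ, EN)) (𝓘(ℝ, EM).prod 𝓘(ℝ, EN))
        (param hg f c p.snd ∘ coord hg c p.snd) p.incl
        (mfderiv 𝓘(ℝ, EM × hg.complement) (𝓘(ℝ, EM).prod 𝓘(ℝ, EN)) incl p u) := by
    conv_lhs => rw [hloc.mfderiv_eq, mfderiv_comp p hpc hincl]
    rfl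
  have e2 : mfderiv (𝓘(ℝ, EM).prod 𝓘(ℝ, EN)) (𝓘(ℝ, EM).prod 𝓘(ℝ, EN))
        (param hg f c p.snd ∘ coord hg c p.snd) p.incl
        (mfderiv 𝓘(ℝ, EM × hg.complement) (𝓘(ℝ, EM).prod 𝓘(ℝ, EN)) incl p u) =
      mfderiv (𝓘(ℝ, EM).prod 𝓘(ℝ, EN)) (𝓘(ℝ, EM).prod 𝓘(ℝ, EN))
        (param hg f c p.snd ∘ coord hg c p.snd) p.incl (v, w) := by
    rw [mfderiv_comp p.incl hparam hcoord]
    exact congrArg (mfderiv 𝓘(ℝ, EM × hg.complement) (𝓘(ℝ, EM).prod 𝓘(ℝ, EN))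
      (param hg f c p.snd) (coord hg c p.snd p.incl)) hu'
  have hKA := MDifferentiableAt.comp (f := A) p.incl hK hA
  have e3 : mfderiv (𝓘(ℝ, EM).prod 𝓘(ℝ, EN)) (𝓘(ℝ, EM).prod 𝓘(ℝ, EN))
        (param hg f c p.snd ∘ coord hg c p.snd) p.incl (v, w) =
      (v, mfderiv (𝓘(ℝ, EM).prod 𝓘(ℝ, EN)) 𝓘(ℝ, EN) (K ∘ A) p.incl (v, w)) := by
    have := (hasMFDerivAt_fst (I := 𝓘(ℝ, EM)) (I' := 𝓘(ℝ, EN)) p.incl).prodMk hKA.hasMFDerivAt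
    rw [hloc'.mfderiv_eq]
    exact congrArg (fun T : EM × EN →L[ℝ] EM × EN => T (v, w)) this.mfderiv
  have e4 : (mfderiv (𝓘(ℝ, EM).prod 𝓘(ℝ, EN)) 𝓘(ℝ, EN) (K ∘ A) p.incl (v, w) : EN) =
      mfderiv 𝓘(ℝ, EN) 𝓘(ℝ, EN) (K ∘ G) p.snd w := by
    have hK' := hK
    rw [hAp] at hK'
    rw [mfderiv_comp p.incl hK hA, mfderiv_comp p.snd hK' hG]
    have a1 : mfderiv (𝓘(ℝ, EM).prod 𝓘(ℝ, EN)) (𝓘(ℝ, EB).prod 𝓘(ℝ, EN)) A p.incl (v, w) =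
        (mfderiv 𝓘(ℝ, EB) 𝓘(ℝ, EB) ψ (f p.fst) (mfderiv 𝓘(ℝ, EM) 𝓘(ℝ, EB) f p.fst v), w) := by
      have h1 := HasMFDerivAt.comp (f := fun q : M × N => f q.1) p.incl hψs'.hasMFDerivAt
        (HasMFDerivAt.comp (f := Prod.fst) p.incl hfs.hasMFDerivAt
          (hasMFDerivAt_fst (I := 𝓘(ℝ, EM)) (I' := 𝓘(ℝ, EN)) p.incl))
      have h2 := h1.prodMk (hasMFDerivAt_snd (I := 𝓘(ℝ, EM)) (I' := 𝓘(ℝ, EN)) p.incl)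
      exact congrArg (fun T : EM × EN →L[ℝ] EB × EN => T (v, w)) h2.mfderiv
    have a2 : mfderiv 𝓘(ℝ, EN) (𝓘(ℝ, EB).prod 𝓘(ℝ, EN)) G p.snd w =
        (mfderiv 𝓘(ℝ, EB) 𝓘(ℝ, EB) ψ (g p.snd) (mfderiv 𝓘(ℝ, EN) 𝓘(ℝ, EB) g p.snd w), w) := by
      have h2 := (hψs.hasMFDerivAt.comp p.snd hgs.hasMFDerivAt).prodMk
        (hasMFDerivAt_id (I := 𝓘(ℝ, EN)) p.snd)
      exact congrArg (fun T : EN →L[ℝ] EB × EN => T w) h2.mfderiv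
    have a3 : ∀ (b b' : B) (t t' : EB), b = b' → t = t' →
        (mfderiv 𝓘(ℝ, EB) 𝓘(ℝ, EB) ψ b t : EB) = mfderiv 𝓘(ℝ, EB) 𝓘(ℝ, EB) ψ b' t' := by
      rintro b _ t _ rfl rfl; rfl
    have a4 : ∀ (y y' : EB × N) (t t' : EB × EN), y = y' → t = t' →
        (mfderiv (𝓘(ℝ, EB).prod 𝓘(ℝ, EN)) 𝓘(ℝ, EN) K y t : EN) =
          mfderiv (𝓘(ℝ, EB).prod 𝓘(ℝ, EN)) 𝓘(ℝ, EN) K y' t' := by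
      rintro b _ t _ rfl rfl; rfl
    exact a4 _ _ _ _ hAp (a1.trans ((congrArg (fun t : EB => ((t, w) : EB × EN))
      (a3 _ _ _ _ p.condition h)).trans a2.symm))
  have e5 : mfderiv 𝓘(ℝ, EN) 𝓘(ℝ, EN) (K ∘ G) p.snd w = w := by
    have : K ∘ G =ᶠ[𝓝 p.snd] id := by
      filter_upwards [d.open_source.mem_nhds hdm] with n hn using hKG n hn
    rw [this.mfderiv_eq]
    exact congrArg (fun T : EN →L[ℝ] EN => T w) (mfderiv_id (I := 𝓘(ℝ, EN)) (x := p.snd))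
  rw [e1, e2, e3]
  exact congrArg (Prod.mk v) (e4.trans e5)

/-- The tangent vector of the fibre product at `p` with components `v` and `w`. -/
def tangentMk (p : FiberProduct hf hg) (v : TangentSpace 𝓘(ℝ, EM) p.fst)
    (w : TangentSpace 𝓘(ℝ, EN) p.snd)
    (h : (mfderiv 𝓘(ℝ, EM) 𝓘(ℝ, EB) f p.fst v : EB) = mfderiv 𝓘(ℝ, EN) 𝓘(ℝ, EB) g p.snd w) :
    TangentSpace 𝓘(ℝ, EM × hg.complement) p :=
  (exists_tangent p v w h).choose

theorem mfderiv_incl_tangentMk (p : FiberProduct hf hg) (v : TangentSpace 𝓘(ℝ, EM) p.fst)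
    (w : TangentSpace 𝓘(ℝ, EN) p.snd)
    (h : (mfderiv 𝓘(ℝ, EM) 𝓘(ℝ, EB) f p.fst v : EB) = mfderiv 𝓘(ℝ, EN) 𝓘(ℝ, EB) g p.snd w) :
    mfderiv 𝓘(ℝ, EM × hg.complement) (𝓘(ℝ, EM).prod 𝓘(ℝ, EN)) incl p (tangentMk p v w h) =
      (v, w) :=
  (exists_tangent p v w h).choose_spec

theorem mfderiv_fst_tangentMk (p : FiberProduct hf hg) (v : TangentSpace 𝓘(ℝ, EM) p.fst)
    (w : TangentSpace 𝓘(ℝ, EN) p.snd)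
    (h : (mfderiv 𝓘(ℝ, EM) 𝓘(ℝ, EB) f p.fst v : EB) = mfderiv 𝓘(ℝ, EN) 𝓘(ℝ, EB) g p.snd w) :
    mfderiv 𝓘(ℝ, EM × hg.complement) 𝓘(ℝ, EM) fst p (tangentMk p v w h) = v := by
  have h1 := (hasMFDerivAt_fst (I := 𝓘(ℝ, EM)) (I' := 𝓘(ℝ, EN)) p.incl).comp p
    ((contMDiff_incl.contMDiffAt (x := p)).mdifferentiableAt (by simp)).hasMFDerivAt
  have h2 := congrArg (fun T : EM × hg.complement →L[ℝ] EM => T (tangentMk p v w h)) h1.mfderiv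
  exact h2.trans (congrArg Prod.fst (mfderiv_incl_tangentMk p v w h))

theorem mfderiv_snd_tangentMk (p : FiberProduct hf hg) (v : TangentSpace 𝓘(ℝ, EM) p.fst)
    (w : TangentSpace 𝓘(ℝ, EN) p.snd)
    (h : (mfderiv 𝓘(ℝ, EM) 𝓘(ℝ, EB) f p.fst v : EB) = mfderiv 𝓘(ℝ, EN) 𝓘(ℝ, EB) g p.snd w) :
    mfderiv 𝓘(ℝ, EM × hg.complement) 𝓘(ℝ, EN) snd p (tangentMk p v w h) = w := by
  have h1 := (hasMFDerivAt_snd (I := 𝓘(ℝ, EM)) (I' := 𝓘(ℝ, EN)) p.incl).comp p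
    ((contMDiff_incl.contMDiffAt (x := p)).mdifferentiableAt (by simp)).hasMFDerivAt
  have h2 := congrArg (fun T : EM × hg.complement →L[ℝ] EN => T (tangentMk p v w h)) h1.mfderiv
  exact h2.trans (congrArg Prod.snd (mfderiv_incl_tangentMk p v w h))

/-- If `a` is a submersion, so is its composition with the first projection. -/
theorem isSubmersion_comp_fst {EC C : Type*} [NormedAddCommGroup EC] [NormedSpace ℝ EC]
    [TopologicalSpace C] [ChartedSpace EC C] {a : M → C}
    (ha : IsSubmersion 𝓘(ℝ, EM) 𝓘(ℝ, EC) ∞ a) :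
    IsSubmersion 𝓘(ℝ, EM × hg.complement) 𝓘(ℝ, EC) ∞ (fun p : FiberProduct hf hg => a p.fst) := by
  refine IsSubmersionOfComplement.isSubmersion (F := ha.complement × hg.complement) fun p => ?_
  refine IsSubmersionAtOfComplement.mk_of_charts
    (((lin ha p.fst).prodCongr (ContinuousLinearEquiv.refl ℝ hg.complement)).trans
      (ContinuousLinearEquiv.prodAssoc ℝ EC ha.complement hg.complement))
    (chart p (dom ha p.fst)) (cod ha p.fst) ⟨mem_dom ha p.fst, mem_dom hg p.snd⟩
    (map_dom ha _ (mem_dom ha p.fst)) (chart_mem (dom_mem ha p.fst) p) (cod_mem ha p.fst)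
    (fun q hq => map_dom ha _ hq.1) ?_
  intro x hx
  have hx₀ : x ∈ (chart p (dom ha p.fst)).target := by simpa using hx
  have hx' : x ∈ chartTarget hg f (dom ha p.fst) p.snd := hx₀
  have h1 : (ofParam p (dom ha p.fst) x).fst = (dom ha p.fst).symm x.1 :=
    congrArg Prod.fst (incl_ofParam p (dom ha p.fst) hx')
  have h2 := written ha p.fst ((dom ha p.fst).map_target hx'.1)
  rw [(dom ha p.fst).right_inv hx'.1] at h2
  change cod ha p.fst (a (ofParam p (dom ha p.fst) x).fst) = (lin ha p.fst x.1).1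
  rw [h1, h2]

end Smooth

end FiberProduct

/-- The composition of a submersion with a smooth involution is a submersion. -/
theorem isSubmersion_comp_involution [IsManifold 𝓘(ℝ, EN) ∞ N]
    (hg : IsSubmersion 𝓘(ℝ, EN) 𝓘(ℝ, EB) ∞ g) {s : N → N}
    (hs : ContMDiff 𝓘(ℝ, EN) 𝓘(ℝ, EN) ∞ s) (hss : Function.Involutive s) :
    IsSubmersion 𝓘(ℝ, EN) 𝓘(ℝ, EB) ∞ (g ∘ s) := by
  refine IsSubmersionOfComplement.isSubmersion (F := hg.complement) fun n => ?_
  let S : N ≃ₜ N := ⟨hss.toPerm, hs.continuous, hs.continuous⟩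
  have hd := FiberProduct.dom_mem hg (s n)
  refine IsSubmersionAtOfComplement.mk_of_charts (FiberProduct.lin hg (s n))
    (S.transOpenPartialHomeomorph (FiberProduct.dom hg (s n))) (FiberProduct.cod hg (s n))
    (FiberProduct.mem_dom hg (s n)) (FiberProduct.map_dom hg _ (FiberProduct.mem_dom hg (s n)))
    (OpenPartialHomeomorph.mem_maximalAtlas_of_contMDiffOn _ ?_ ?_) (FiberProduct.cod_mem hg (s n))
    (fun q hq => FiberProduct.map_dom hg _ hq) ?_
  · exact (contMDiffOn_of_mem_maximalAtlas hd).comp hs.contMDiffOn fun x hx => hx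
  · exact hs.comp_contMDiffOn (contMDiffOn_symm_of_mem_maximalAtlas hd)
  · intro x hx
    have hx' : x ∈ (FiberProduct.dom hg (s n)).target := by simpa using hx
    have h2 := FiberProduct.written hg (s n) ((FiberProduct.dom hg (s n)).map_target hx')
    rw [(FiberProduct.dom hg (s n)).right_inv hx'] at h2
    change FiberProduct.cod hg (s n) (g (s (s ((FiberProduct.dom hg (s n)).symm x)))) =
      (FiberProduct.lin hg (s n) x).1
    rw [hss, h2]

end FiberProduct

section Groupoid

/-- A Lie groupoid `G ⇉ B` with source `src` (written `α`), target `tgt` (written `β`), object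
inclusion `unit` and partial multiplication `mul`, where `g g'` is defined when `β g = α g'`. -/
structure LieGroupoid (EB B EG G : Type*)
    [NormedAddCommGroup EB] [NormedSpace ℝ EB] [NormedAddCommGroup EG] [NormedSpace ℝ EG]
    [TopologicalSpace B] [ChartedSpace EB B] [IsManifold 𝓘(ℝ, EB) ∞ B]
    [TopologicalSpace G] [ChartedSpace EG G] [IsManifold 𝓘(ℝ, EG) ∞ G] where
  src : G → B
  tgt : G → B
  src_submersion : IsSubmersion 𝓘(ℝ, EG) 𝓘(ℝ, EB) ∞ src
  tgt_submersion : IsSubmersion 𝓘(ℝ, EG) 𝓘(ℝ, EB) ∞ tgt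
  unit : B → G
  unit_smooth : ContMDiff 𝓘(ℝ, EB) 𝓘(ℝ, EG) ∞ unit
  mul : FiberProduct tgt_submersion.contMDiff src_submersion → G
  mul_smooth : ContMDiff 𝓘(ℝ, EG × src_submersion.complement) 𝓘(ℝ, EG) ∞ mul
  inv : G → G
  inv_smooth : ContMDiff 𝓘(ℝ, EG) 𝓘(ℝ, EG) ∞ inv
  src_mul : ∀ p, src (mul p) = src p.fst
  tgt_mul : ∀ p, tgt (mul p) = tgt p.snd
  mul_assoc : ∀ (g g' g'' : G) (h : tgt g = src g') (h' : tgt g' = src g'')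
    (h₁ : tgt g = src (mul ⟨g', g'', h'⟩)) (h₂ : tgt (mul ⟨g, g', h⟩) = src g''),
    mul ⟨g, mul ⟨g', g'', h'⟩, h₁⟩ = mul ⟨mul ⟨g, g', h⟩, g'', h₂⟩
  src_unit : ∀ b, src (unit b) = b
  tgt_unit : ∀ b, tgt (unit b) = b
  mul_unit : ∀ (g : G) (h : tgt g = src (unit (tgt g))), mul ⟨g, unit (tgt g), h⟩ = g
  unit_mul : ∀ (g : G) (h : tgt (unit (src g)) = src g), mul ⟨unit (src g), g, h⟩ = g
  src_inv : ∀ g, src (inv g) = tgt g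
  tgt_inv : ∀ g, tgt (inv g) = src g
  inv_mul : ∀ (g : G) (h : tgt (inv g) = src g), mul ⟨inv g, g, h⟩ = unit (tgt g)
  mul_inv : ∀ (g : G) (h : tgt g = src (inv g)), mul ⟨g, inv g, h⟩ = unit (src g)

variable {EB B EG G EH H : Type*}
  [NormedAddCommGroup EB] [NormedSpace ℝ EB] [NormedAddCommGroup EG] [NormedSpace ℝ EG]
  [NormedAddCommGroup EH] [NormedSpace ℝ EH]
  [TopologicalSpace B] [ChartedSpace EB B] [IsManifold 𝓘(ℝ, EB) ∞ B]
  [TopologicalSpace G] [ChartedSpace EG G] [IsManifold 𝓘(ℝ, EG) ∞ G]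
  [TopologicalSpace H] [ChartedSpace EH H] [IsManifold 𝓘(ℝ, EH) ∞ H]

namespace LieGroupoid

variable (𝒢 : LieGroupoid EB B EG G)

theorem mul_congr {a a' b b' : G} (ha : a = a') (hb : b = b') {h : 𝒢.tgt a = 𝒢.src b}
    {h' : 𝒢.tgt a' = 𝒢.src b'} : 𝒢.mul ⟨a, b, h⟩ = 𝒢.mul ⟨a', b', h'⟩ := by
  subst ha hb; rfl

theorem mul_unit' {g : G} {b : B} (hb : 𝒢.tgt g = b) {h : 𝒢.tgt g = 𝒢.src (𝒢.unit b)} :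
    𝒢.mul ⟨g, 𝒢.unit b, h⟩ = g := by
  subst hb; exact 𝒢.mul_unit g h

theorem unit_mul' {g : G} {b : B} (hb : 𝒢.src g = b) {h : 𝒢.tgt (𝒢.unit b) = 𝒢.src g} :
    𝒢.mul ⟨𝒢.unit b, g, h⟩ = g := by
  subst hb; exact 𝒢.unit_mul g h

/-- A right inverse is the inverse. -/
theorem eq_inv_of_mul {g g' : G} (h : 𝒢.tgt g = 𝒢.src g')
    (h' : 𝒢.mul ⟨g, g', h⟩ = 𝒢.unit (𝒢.src g)) : g' = 𝒢.inv g := by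
  have e1 : 𝒢.tgt (𝒢.inv g) = 𝒢.src g := 𝒢.tgt_inv g
  have e2 : 𝒢.tgt (𝒢.mul ⟨𝒢.inv g, g, e1⟩) = 𝒢.src g' := by rw [𝒢.tgt_mul]; exact h
  have e3 : 𝒢.tgt (𝒢.inv g) = 𝒢.src (𝒢.mul ⟨g, g', h⟩) := by rw [𝒢.src_mul]; exact e1
  have e4 := 𝒢.mul_assoc (𝒢.inv g) g g' e1 h e3 e2
  have e5 : 𝒢.mul ⟨𝒢.inv g, 𝒢.mul ⟨g, g', h⟩, e3⟩ = 𝒢.inv g :=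
    (𝒢.mul_congr rfl h' (h' := by rw [𝒢.src_unit]; exact e1)).trans (𝒢.mul_unit' e1)
  have e6 : 𝒢.mul ⟨𝒢.mul ⟨𝒢.inv g, g, e1⟩, g', e2⟩ = g' :=
    (𝒢.mul_congr (𝒢.inv_mul g e1) rfl (h' := by rw [𝒢.tgt_unit]; exact h)).trans
      (𝒢.unit_mul' h.symm)
  exact (e6.symm.trans e4.symm).trans e5

theorem inv_inv (g : G) : 𝒢.inv (𝒢.inv g) = g := by
  have e1 : 𝒢.tgt (𝒢.inv g) = 𝒢.src g := 𝒢.tgt_inv g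
  refine (𝒢.eq_inv_of_mul e1 ?_).symm
  rw [𝒢.inv_mul, 𝒢.src_inv]

theorem inv_unit (b : B) : 𝒢.inv (𝒢.unit b) = 𝒢.unit b := by
  have e : 𝒢.tgt (𝒢.unit b) = 𝒢.src (𝒢.unit b) := by rw [𝒢.tgt_unit, 𝒢.src_unit]
  refine (𝒢.eq_inv_of_mul e ?_).symm
  rw [𝒢.mul_unit' (𝒢.tgt_unit b), 𝒢.src_unit]

/-- An idempotent loop is a unit. -/
theorem eq_unit_of_idem {u : G} {b : B} (hb : 𝒢.src u = b) (h : 𝒢.tgt u = 𝒢.src u)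
    (hu : 𝒢.mul ⟨u, u, h⟩ = u) : u = 𝒢.unit b := by
  subst hb
  have e1 : 𝒢.tgt (𝒢.inv u) = 𝒢.src u := 𝒢.tgt_inv u
  have e2 : 𝒢.tgt (𝒢.mul ⟨𝒢.inv u, u, e1⟩) = 𝒢.src u := by rw [𝒢.tgt_mul]; exact h
  have e3 : 𝒢.tgt (𝒢.inv u) = 𝒢.src (𝒢.mul ⟨u, u, h⟩) := by rw [𝒢.src_mul]; exact e1
  have e4 := 𝒢.mul_assoc (𝒢.inv u) u u e1 h e3 e2
  rw [𝒢.mul_congr rfl hu (h' := e1), 𝒢.mul_congr (𝒢.inv_mul u e1) rfl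
    (h' := by rw [𝒢.tgt_unit]; exact h), 𝒢.unit_mul' h.symm, 𝒢.inv_mul, h] at e4
  exact e4.symm

end LieGroupoid

/-- A matched pair of Lie groupoids over `B`: a smooth left action `h ▷ g` of `ℋ` on (the source map
of) `𝒢` and a smooth right action `h ◁ g` of `𝒢` on (the target map of) `ℋ`, both defined when
`β h = α g`, subject to the compatibility conditions. -/
structure MatchedPair (𝒢 : LieGroupoid EB B EG G) (ℋ : LieGroupoid EB B EH H) where
  /-- `h ▷ g` -/
  lact : FiberProduct ℋ.tgt_submersion.contMDiff 𝒢.src_submersion → G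
  /-- `h ◁ g` -/
  ract : FiberProduct ℋ.tgt_submersion.contMDiff 𝒢.src_submersion → H
  lact_smooth : ContMDiff 𝓘(ℝ, EH × 𝒢.src_submersion.complement) 𝓘(ℝ, EG) ∞ lact
  ract_smooth : ContMDiff 𝓘(ℝ, EH × 𝒢.src_submersion.complement) 𝓘(ℝ, EH) ∞ ract
  src_lact : ∀ p, 𝒢.src (lact p) = ℋ.src p.fst
  mul_lact : ∀ (h' h : H) (g : G) (e : ℋ.tgt h' = ℋ.src h) (e₁ : ℋ.tgt h = 𝒢.src g)
    (e₂ : ℋ.tgt (ℋ.mul ⟨h', h, e⟩) = 𝒢.src g) (e₃ : ℋ.tgt h' = 𝒢.src (lact ⟨h, g, e₁⟩)),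
    lact ⟨ℋ.mul ⟨h', h, e⟩, g, e₂⟩ = lact ⟨h', lact ⟨h, g, e₁⟩, e₃⟩
  unit_lact : ∀ (g : G) (e : ℋ.tgt (ℋ.unit (𝒢.src g)) = 𝒢.src g),
    lact ⟨ℋ.unit (𝒢.src g), g, e⟩ = g
  tgt_ract : ∀ p, ℋ.tgt (ract p) = 𝒢.tgt p.snd
  ract_mul : ∀ (h : H) (g' g : G) (e : ℋ.tgt h = 𝒢.src g') (e₁ : 𝒢.tgt g' = 𝒢.src g)
    (e₂ : ℋ.tgt h = 𝒢.src (𝒢.mul ⟨g', g, e₁⟩)) (e₃ : ℋ.tgt (ract ⟨h, g', e⟩) = 𝒢.src g),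
    ract ⟨h, 𝒢.mul ⟨g', g, e₁⟩, e₂⟩ = ract ⟨ract ⟨h, g', e⟩, g, e₃⟩
  ract_unit : ∀ (h : H) (e : ℋ.tgt h = 𝒢.src (𝒢.unit (ℋ.tgt h))),
    ract ⟨h, 𝒢.unit (ℋ.tgt h), e⟩ = h
  tgt_lact : ∀ p, 𝒢.tgt (lact p) = ℋ.src (ract p)
  lact_mul : ∀ (h : H) (g' g : G) (e : ℋ.tgt h = 𝒢.src g') (e₁ : 𝒢.tgt g' = 𝒢.src g)
    (e₂ : ℋ.tgt h = 𝒢.src (𝒢.mul ⟨g', g, e₁⟩)) (e₃ : ℋ.tgt (ract ⟨h, g', e⟩) = 𝒢.src g)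
    (e₄ : 𝒢.tgt (lact ⟨h, g', e⟩) = 𝒢.src (lact ⟨ract ⟨h, g', e⟩, g, e₃⟩)),
    lact ⟨h, 𝒢.mul ⟨g', g, e₁⟩, e₂⟩ =
      𝒢.mul ⟨lact ⟨h, g', e⟩, lact ⟨ract ⟨h, g', e⟩, g, e₃⟩, e₄⟩
  mul_ract : ∀ (h' h : H) (g : G) (e : ℋ.tgt h' = ℋ.src h) (e₁ : ℋ.tgt h = 𝒢.src g)
    (e₂ : ℋ.tgt (ℋ.mul ⟨h', h, e⟩) = 𝒢.src g) (e₃ : ℋ.tgt h' = 𝒢.src (lact ⟨h, g, e₁⟩))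
    (e₄ : ℋ.tgt (ract ⟨h', lact ⟨h, g, e₁⟩, e₃⟩) = ℋ.src (ract ⟨h, g, e₁⟩)),
    ract ⟨ℋ.mul ⟨h', h, e⟩, g, e₂⟩ =
      ℋ.mul ⟨ract ⟨h', lact ⟨h, g, e₁⟩, e₃⟩, ract ⟨h, g, e₁⟩, e₄⟩

namespace MatchedPair

variable {𝒢 : LieGroupoid EB B EG G} {ℋ : LieGroupoid EB B EH H} (P : MatchedPair 𝒢 ℋ)

theorem lact_congr {a a' : H} {b b' : G} (ha : a = a') (hb : b = b') {h : ℋ.tgt a = 𝒢.src b}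
    {h' : ℋ.tgt a' = 𝒢.src b'} : P.lact ⟨a, b, h⟩ = P.lact ⟨a', b', h'⟩ := by
  subst ha hb; rfl

theorem ract_congr {a a' : H} {b b' : G} (ha : a = a') (hb : b = b') {h : ℋ.tgt a = 𝒢.src b}
    {h' : ℋ.tgt a' = 𝒢.src b'} : P.ract ⟨a, b, h⟩ = P.ract ⟨a', b', h'⟩ := by
  subst ha hb; rfl

theorem unit_lact' {g : G} {b : B} (hb : 𝒢.src g = b) {e : ℋ.tgt (ℋ.unit b) = 𝒢.src g} :
    P.lact ⟨ℋ.unit b, g, e⟩ = g := by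
  subst hb; exact P.unit_lact g e

theorem ract_unit' {h : H} {b : B} (hb : ℋ.tgt h = b) {e : ℋ.tgt h = 𝒢.src (𝒢.unit b)} :
    P.ract ⟨h, 𝒢.unit b, e⟩ = h := by
  subst hb; exact P.ract_unit h e

theorem lact_unit {h : H} {b : B} (hb : ℋ.tgt h = b) {e : ℋ.tgt h = 𝒢.src (𝒢.unit b)} :
    P.lact ⟨h, 𝒢.unit b, e⟩ = 𝒢.unit (ℋ.src h) := by
  have e1 : 𝒢.tgt (𝒢.unit b) = 𝒢.src (𝒢.unit b) := by rw [𝒢.tgt_unit, 𝒢.src_unit]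
  have e2 : P.ract ⟨h, 𝒢.unit b, e⟩ = h := P.ract_unit' hb
  have e3 : 𝒢.tgt (P.lact ⟨h, 𝒢.unit b, e⟩) = 𝒢.src (P.lact ⟨h, 𝒢.unit b, e⟩) := by
    rw [P.tgt_lact, P.src_lact, e2]
  refine 𝒢.eq_unit_of_idem (P.src_lact _) e3 ?_
  have e4 : 𝒢.mul ⟨𝒢.unit b, 𝒢.unit b, e1⟩ = 𝒢.unit b := 𝒢.mul_unit' (𝒢.tgt_unit b)
  have e5 : P.lact ⟨P.ract ⟨h, 𝒢.unit b, e⟩, 𝒢.unit b, by rw [e2]; exact e⟩ =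
    P.lact ⟨h, 𝒢.unit b, e⟩ := P.lact_congr e2 rfl
  have e6 := P.lact_mul h (𝒢.unit b) (𝒢.unit b) e e1 (by rw [e4]; exact e) (by rw [e2]; exact e)
    (by rw [e5]; exact e3)
  rw [𝒢.mul_congr rfl e5 (h' := e3), P.lact_congr rfl e4 (h' := e)] at e6
  exact e6.symm

theorem unit_ract {g : G} {b : B} (hb : 𝒢.src g = b) {e : ℋ.tgt (ℋ.unit b) = 𝒢.src g} :
    P.ract ⟨ℋ.unit b, g, e⟩ = ℋ.unit (𝒢.tgt g) := by
  have e1 : ℋ.tgt (ℋ.unit b) = ℋ.src (ℋ.unit b) := by rw [ℋ.tgt_unit, ℋ.src_unit]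
  have e2 : P.lact ⟨ℋ.unit b, g, e⟩ = g := P.unit_lact' hb
  have e3 : ℋ.tgt (P.ract ⟨ℋ.unit b, g, e⟩) = ℋ.src (P.ract ⟨ℋ.unit b, g, e⟩) := by
    rw [P.tgt_ract, ← P.tgt_lact, e2]
  refine ℋ.eq_unit_of_idem (by rw [← P.tgt_lact, e2]) e3 ?_
  have e4 : ℋ.mul ⟨ℋ.unit b, ℋ.unit b, e1⟩ = ℋ.unit b := ℋ.mul_unit' (ℋ.tgt_unit b)
  have e5 : P.ract ⟨ℋ.unit b, P.lact ⟨ℋ.unit b, g, e⟩, by rw [e2]; exact e⟩ =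
    P.ract ⟨ℋ.unit b, g, e⟩ := P.ract_congr rfl e2
  have e6 := P.mul_ract (ℋ.unit b) (ℋ.unit b) g e1 e (by rw [e4]; exact e) (by rw [e2]; exact e)
    (by rw [e5]; exact e3)
  rw [ℋ.mul_congr e5 rfl (h' := e3), P.ract_congr e4 rfl (h' := e)] at e6
  exact e6.symm

/-- The space of arrows `𝒢 ⋈ ℋ = {(g, h) | β g = α h}` of the matched pair Lie groupoid. -/
abbrev Arrow (_P : MatchedPair 𝒢 ℋ) : Type _ :=
  FiberProduct 𝒢.tgt_submersion.contMDiff ℋ.src_submersion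

/-- The model space of the manifold `𝒢 ⋈ ℋ`. -/
abbrev Model (_P : MatchedPair 𝒢 ℋ) : Type _ := EG × ℋ.src_submersion.complement

def arrowSrc (p : P.Arrow) : B := 𝒢.src p.fst

def arrowTgt (p : P.Arrow) : B := ℋ.tgt p.snd

def arrowUnit (b : B) : P.Arrow := ⟨𝒢.unit b, ℋ.unit b, by rw [𝒢.tgt_unit, ℋ.src_unit]⟩

/-- `(g, h)⁻¹ = (h⁻¹ ▷ g⁻¹, h⁻¹ ◁ g⁻¹)` -/
def arrowInv (p : P.Arrow) : P.Arrow :=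
  ⟨P.lact ⟨ℋ.inv p.snd, 𝒢.inv p.fst, by rw [ℋ.tgt_inv, 𝒢.src_inv]; exact p.condition.symm⟩,
    P.ract ⟨ℋ.inv p.snd, 𝒢.inv p.fst, by rw [ℋ.tgt_inv, 𝒢.src_inv]; exact p.condition.symm⟩,
    P.tgt_lact _⟩

theorem arrowInv_smooth : ContMDiff 𝓘(ℝ, P.Model) 𝓘(ℝ, P.Model) ∞ P.arrowInv := by
  have h : ContMDiff 𝓘(ℝ, P.Model) 𝓘(ℝ, EH × 𝒢.src_submersion.complement) ∞
      (fun p : P.Arrow => (⟨ℋ.inv p.snd, 𝒢.inv p.fst, by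
        rw [ℋ.tgt_inv, 𝒢.src_inv]; exact p.condition.symm⟩ :
        FiberProduct ℋ.tgt_submersion.contMDiff 𝒢.src_submersion)) :=
    FiberProduct.contMDiff_of_components (ℋ.inv_smooth.comp FiberProduct.contMDiff_snd)
      (𝒢.inv_smooth.comp FiberProduct.contMDiff_fst)
  exact FiberProduct.contMDiff_of_components (P.lact_smooth.comp h) (P.ract_smooth.comp h)

/-- `(h ▷ g)⁻¹ = (h ◁ g) ▷ g⁻¹` -/
theorem inv_lact {h : H} {g : G} {e : ℋ.tgt h = 𝒢.src g}
    {e' : ℋ.tgt (P.ract ⟨h, g, e⟩) = 𝒢.src (𝒢.inv g)} :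
    𝒢.inv (P.lact ⟨h, g, e⟩) = P.lact ⟨P.ract ⟨h, g, e⟩, 𝒢.inv g, e'⟩ := by
  have e1 : 𝒢.tgt (P.lact ⟨h, g, e⟩) = 𝒢.src (P.lact ⟨P.ract ⟨h, g, e⟩, 𝒢.inv g, e'⟩) := by
    rw [P.tgt_lact, P.src_lact]
  have e2 : 𝒢.tgt g = 𝒢.src (𝒢.inv g) := (𝒢.src_inv g).symm
  have e3 : ℋ.tgt h = 𝒢.src (𝒢.mul ⟨g, 𝒢.inv g, e2⟩) := by rw [𝒢.src_mul]; exact e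
  refine (𝒢.eq_inv_of_mul e1 ?_).symm
  rw [← P.lact_mul h g (𝒢.inv g) e e2 e3 e' e1, P.src_lact]
  refine (P.lact_congr rfl (𝒢.mul_inv g e2) (h' := by rw [𝒢.src_unit]; exact e)).trans ?_
  exact P.lact_unit e

/-- `(h ◁ g)⁻¹ = h⁻¹ ◁ (h ▷ g)` -/
theorem inv_ract {h : H} {g : G} {e : ℋ.tgt h = 𝒢.src g}
    {e' : ℋ.tgt (ℋ.inv h) = 𝒢.src (P.lact ⟨h, g, e⟩)} :
    ℋ.inv (P.ract ⟨h, g, e⟩) = P.ract ⟨ℋ.inv h, P.lact ⟨h, g, e⟩, e'⟩ := by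
  have e1 : ℋ.tgt (P.ract ⟨ℋ.inv h, P.lact ⟨h, g, e⟩, e'⟩) = ℋ.src (P.ract ⟨h, g, e⟩) := by
    rw [P.tgt_ract, P.tgt_lact]
  have e2 : ℋ.tgt (ℋ.inv h) = ℋ.src h := ℋ.tgt_inv h
  have e3 : ℋ.tgt (ℋ.mul ⟨ℋ.inv h, h, e2⟩) = 𝒢.src g := by rw [ℋ.tgt_mul]; exact e
  have e4 : P.ract ⟨h, g, e⟩ = ℋ.inv (P.ract ⟨ℋ.inv h, P.lact ⟨h, g, e⟩, e'⟩) := by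
    refine ℋ.eq_inv_of_mul e1 ?_
    rw [← P.mul_ract (ℋ.inv h) h g e2 e e3 e' e1, ← P.tgt_lact]
    refine (P.ract_congr (ℋ.inv_mul h e2) rfl (h' := by rw [ℋ.tgt_unit]; exact e)).trans ?_
    rw [P.unit_ract e.symm, ← P.mul_lact (ℋ.inv h) h g e2 e e3 e']
    congr 1
    refine Eq.trans ?_ (congrArg 𝒢.tgt (P.lact_congr (ℋ.inv_mul h e2) rfl
      (h' := by rw [ℋ.tgt_unit]; exact e))).symm
    rw [P.unit_lact' e.symm]
  rw [e4, ℋ.inv_inv]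

theorem arrowInv_involutive : Function.Involutive P.arrowInv := by
  intro p
  have e : ℋ.tgt (ℋ.inv p.snd) = 𝒢.src (𝒢.inv p.fst) := by
    rw [ℋ.tgt_inv, 𝒢.src_inv]; exact p.condition.symm
  have a1 : 𝒢.inv (P.lact ⟨ℋ.inv p.snd, 𝒢.inv p.fst, e⟩) =
      P.lact ⟨P.ract ⟨ℋ.inv p.snd, 𝒢.inv p.fst, e⟩, 𝒢.inv (𝒢.inv p.fst), by
        rw [P.tgt_ract, 𝒢.src_inv]⟩ := P.inv_lact
  have a2 : ℋ.inv (P.ract ⟨ℋ.inv p.snd, 𝒢.inv p.fst, e⟩) =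
      P.ract ⟨ℋ.inv (ℋ.inv p.snd), P.lact ⟨ℋ.inv p.snd, 𝒢.inv p.fst, e⟩, by
        rw [ℋ.tgt_inv, P.src_lact]⟩ := P.inv_ract
  set h₁ := P.ract ⟨ℋ.inv p.snd, 𝒢.inv p.fst, e⟩ with hh₁
  set g₁ := P.lact ⟨ℋ.inv p.snd, 𝒢.inv p.fst, e⟩ with hg₁
  have b0 : 𝒢.tgt g₁ = ℋ.src h₁ := P.tgt_lact _
  have b1 : ℋ.tgt h₁ = 𝒢.src p.fst := by rw [hh₁, P.tgt_ract, 𝒢.tgt_inv]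
  have b2 : ℋ.tgt (ℋ.inv h₁) = 𝒢.src (𝒢.inv g₁) := by rw [ℋ.tgt_inv, 𝒢.src_inv, b0]
  have b3 : ℋ.tgt p.snd = 𝒢.src g₁ := by rw [hg₁, P.src_lact, ℋ.src_inv]
  rw [P.lact_congr rfl (𝒢.inv_inv p.fst) (h' := b1)] at a1
  rw [P.ract_congr (ℋ.inv_inv p.snd) rfl (h' := b3)] at a2
  refine FiberProduct.ext (?_ : P.lact ⟨ℋ.inv h₁, 𝒢.inv g₁, b2⟩ = p.fst)
    (?_ : P.ract ⟨ℋ.inv h₁, 𝒢.inv g₁, b2⟩ = p.snd)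
  · have c1 : ℋ.tgt (ℋ.inv h₁) = ℋ.src h₁ := ℋ.tgt_inv h₁
    have c2 : ℋ.tgt (ℋ.inv h₁) = 𝒢.src (P.lact ⟨h₁, p.fst, b1⟩) := by rw [P.src_lact]; exact c1
    have c3 : ℋ.tgt (ℋ.mul ⟨ℋ.inv h₁, h₁, c1⟩) = 𝒢.src p.fst := by rw [ℋ.tgt_mul]; exact b1
    rw [P.lact_congr rfl a1 (h' := c2), ← P.mul_lact _ _ _ c1 b1 c3 c2,
      P.lact_congr (ℋ.inv_mul h₁ c1) rfl (h' := by rw [ℋ.tgt_unit]; exact b1)]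
    exact P.unit_lact' b1.symm
  · have c1 : 𝒢.tgt g₁ = 𝒢.src (𝒢.inv g₁) := (𝒢.src_inv g₁).symm
    have c2 : ℋ.tgt (P.ract ⟨p.snd, g₁, b3⟩) = 𝒢.src (𝒢.inv g₁) := by rw [P.tgt_ract]; exact c1
    have c3 : ℋ.tgt p.snd = 𝒢.src (𝒢.mul ⟨g₁, 𝒢.inv g₁, c1⟩) := by rw [𝒢.src_mul]; exact b3
    rw [P.ract_congr a2 rfl (h' := c2), ← P.ract_mul _ _ _ b3 c1 c3 c2,
      P.ract_congr rfl (𝒢.mul_inv g₁ c1) (h' := by rw [𝒢.src_unit]; exact b3)]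
    exact P.ract_unit' b3

theorem arrowSrc_submersion : IsSubmersion 𝓘(ℝ, P.Model) 𝓘(ℝ, EB) ∞ P.arrowSrc :=
  FiberProduct.isSubmersion_comp_fst 𝒢.src_submersion

theorem arrowTgt_submersion : IsSubmersion 𝓘(ℝ, P.Model) 𝓘(ℝ, EB) ∞ P.arrowTgt := by
  have h := isSubmersion_comp_involution P.arrowSrc_submersion P.arrowInv_smooth
    P.arrowInv_involutive
  have : P.arrowSrc ∘ P.arrowInv = P.arrowTgt := by
    funext p
    change 𝒢.src (P.lact _) = ℋ.tgt p.snd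
    rw [P.src_lact, ℋ.src_inv]
  rwa [this] at h

/-- `(g, h) (g', h') = (g (h ▷ g'), (h ◁ g') h')` -/
def arrowMul (z : FiberProduct P.arrowTgt_submersion.contMDiff P.arrowSrc_submersion) : P.Arrow :=
  ⟨𝒢.mul ⟨z.fst.fst, P.lact ⟨z.fst.snd, z.snd.fst, z.condition⟩, by
      rw [P.src_lact]; exact z.fst.condition⟩,
    ℋ.mul ⟨P.ract ⟨z.fst.snd, z.snd.fst, z.condition⟩, z.snd.snd, by
      rw [P.tgt_ract]; exact z.snd.condition⟩, by
    rw [𝒢.tgt_mul, ℋ.src_mul]; exact P.tgt_lact _⟩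

theorem arrowMul_smooth : ContMDiff 𝓘(ℝ, P.Model × P.arrowSrc_submersion.complement)
    𝓘(ℝ, P.Model) ∞ P.arrowMul := by
  have hz : ContMDiff 𝓘(ℝ, P.Model × P.arrowSrc_submersion.complement)
      𝓘(ℝ, EH × 𝒢.src_submersion.complement) ∞
      (fun z : FiberProduct P.arrowTgt_submersion.contMDiff P.arrowSrc_submersion =>
        (⟨z.fst.snd, z.snd.fst, z.condition⟩ :
          FiberProduct ℋ.tgt_submersion.contMDiff 𝒢.src_submersion)) :=
    FiberProduct.contMDiff_of_components
      (FiberProduct.contMDiff_snd.comp FiberProduct.contMDiff_fst)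
      (FiberProduct.contMDiff_fst.comp FiberProduct.contMDiff_snd)
  have h1 : ContMDiff 𝓘(ℝ, P.Model × P.arrowSrc_submersion.complement) 𝓘(ℝ, EG) ∞
      (fun z : FiberProduct P.arrowTgt_submersion.contMDiff P.arrowSrc_submersion => z.fst.fst) :=
    FiberProduct.contMDiff_fst.comp FiberProduct.contMDiff_fst
  have h2 : ContMDiff 𝓘(ℝ, P.Model × P.arrowSrc_submersion.complement) 𝓘(ℝ, EH) ∞
      (fun z : FiberProduct P.arrowTgt_submersion.contMDiff P.arrowSrc_submersion => z.snd.snd) :=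
    FiberProduct.contMDiff_snd.comp FiberProduct.contMDiff_snd
  refine FiberProduct.contMDiff_of_components (𝒢.mul_smooth.comp ?_) (ℋ.mul_smooth.comp ?_)
  · exact FiberProduct.contMDiff_of_components h1 (P.lact_smooth.comp hz)
  · exact FiberProduct.contMDiff_of_components (P.ract_smooth.comp hz) h2

/-- The matched pair Lie groupoid `𝒢 ⋈ ℋ`. -/
def groupoid : LieGroupoid EB B P.Model P.Arrow where
  src := P.arrowSrc
  tgt := P.arrowTgt
  src_submersion := P.arrowSrc_submersion
  tgt_submersion := P.arrowTgt_submersion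
  unit := P.arrowUnit
  unit_smooth := FiberProduct.contMDiff_of_components 𝒢.unit_smooth ℋ.unit_smooth
  mul := P.arrowMul
  mul_smooth := P.arrowMul_smooth
  inv := P.arrowInv
  inv_smooth := P.arrowInv_smooth
  src_mul z := 𝒢.src_mul _
  tgt_mul z := ℋ.tgt_mul _
  mul_assoc := by
    rintro ⟨g₁, h₁, c₁⟩ ⟨g₂, h₂, c₂⟩ ⟨g₃, h₃, c₃⟩ e e' e₁ e₂
    have d1 : ℋ.tgt h₁ = 𝒢.src g₂ := e
    have d2 : ℋ.tgt h₂ = 𝒢.src g₃ := e'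
    have d3 : 𝒢.tgt g₂ = 𝒢.src (P.lact ⟨h₂, g₃, d2⟩) := by rw [P.src_lact]; exact c₂
    have d4 : ℋ.tgt (P.ract ⟨h₁, g₂, d1⟩) = ℋ.src h₂ := by rw [P.tgt_ract]; exact c₂
    have d5 : ℋ.tgt h₁ = 𝒢.src (𝒢.mul ⟨g₂, P.lact ⟨h₂, g₃, d2⟩, d3⟩) := by
      rw [𝒢.src_mul]; exact d1
    have d6 : ℋ.tgt (ℋ.mul ⟨P.ract ⟨h₁, g₂, d1⟩, h₂, d4⟩) = 𝒢.src g₃ := by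
      rw [ℋ.tgt_mul]; exact d2
    have d7 : ℋ.tgt (P.ract ⟨h₁, g₂, d1⟩) = 𝒢.src (P.lact ⟨h₂, g₃, d2⟩) := by
      rw [P.src_lact]; exact d4
    have d8 : 𝒢.tgt g₁ = 𝒢.src (P.lact ⟨h₁, g₂, d1⟩) := by rw [P.src_lact]; exact c₁
    have d9 : ℋ.tgt (P.ract ⟨h₂, g₃, d2⟩) = ℋ.src h₃ := by rw [P.tgt_ract]; exact c₃
    have d10 : 𝒢.tgt (P.lact ⟨h₁, g₂, d1⟩) =
        𝒢.src (P.lact ⟨P.ract ⟨h₁, g₂, d1⟩, P.lact ⟨h₂, g₃, d2⟩, d7⟩) := by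
      rw [P.tgt_lact, P.src_lact]
    have d11 : ℋ.tgt (P.ract ⟨P.ract ⟨h₁, g₂, d1⟩, P.lact ⟨h₂, g₃, d2⟩, d7⟩) =
        ℋ.src (P.ract ⟨h₂, g₃, d2⟩) := by
      rw [P.tgt_ract, P.tgt_lact]
    refine FiberProduct.ext ?_ ?_
    · refine (𝒢.mul_congr rfl (P.lact_mul h₁ g₂ (P.lact ⟨h₂, g₃, d2⟩) d1 d3 d5 d7 d10)
        (h' := by rw [𝒢.src_mul]; exact d8)).trans ?_
      refine (𝒢.mul_assoc _ _ _ d8 d10 _ (by rw [𝒢.tgt_mul]; exact d10)).trans ?_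
      exact 𝒢.mul_congr rfl (P.mul_lact (P.ract ⟨h₁, g₂, d1⟩) h₂ g₃ d4 d2 d6 d7).symm
    · refine Eq.symm ?_
      refine (ℋ.mul_congr (P.mul_ract (P.ract ⟨h₁, g₂, d1⟩) h₂ g₃ d4 d2 d6 d7 d11) rfl
        (h' := by rw [ℋ.tgt_mul]; exact d9)).trans ?_
      refine (ℋ.mul_assoc _ _ _ d11 d9 (by rw [ℋ.src_mul]; exact d11) _).symm.trans ?_
      exact ℋ.mul_congr (P.ract_mul h₁ g₂ (P.lact ⟨h₂, g₃, d2⟩) d1 d3 d5 d7).symm rfl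
  src_unit b := 𝒢.src_unit b
  tgt_unit b := ℋ.tgt_unit b
  mul_unit := by
    rintro ⟨g, h, c⟩ e
    have d1 : ℋ.tgt h = 𝒢.src (𝒢.unit (ℋ.tgt h)) := e
    have d2 : P.lact ⟨h, 𝒢.unit (ℋ.tgt h), d1⟩ = 𝒢.unit (ℋ.src h) := P.lact_unit rfl
    have d3 : P.ract ⟨h, 𝒢.unit (ℋ.tgt h), d1⟩ = h := P.ract_unit h d1
    refine FiberProduct.ext ?_ ?_
    · exact (𝒢.mul_congr rfl d2 (h' := by rw [𝒢.src_unit]; exact c)).trans (𝒢.mul_unit' c)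
    · exact (ℋ.mul_congr d3 rfl (h' := (ℋ.src_unit _).symm)).trans (ℋ.mul_unit' rfl)
  unit_mul := by
    rintro ⟨g, h, c⟩ e
    have d1 : ℋ.tgt (ℋ.unit (𝒢.src g)) = 𝒢.src g := e
    have d2 : P.lact ⟨ℋ.unit (𝒢.src g), g, d1⟩ = g := P.unit_lact g d1
    have d3 : P.ract ⟨ℋ.unit (𝒢.src g), g, d1⟩ = ℋ.unit (𝒢.tgt g) := P.unit_ract rfl
    refine FiberProduct.ext ?_ ?_
    · exact (𝒢.mul_congr rfl d2 (h' := 𝒢.tgt_unit _)).trans (𝒢.unit_mul' rfl)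
    · exact (ℋ.mul_congr d3 rfl (h' := by rw [ℋ.tgt_unit]; exact c)).trans (ℋ.unit_mul' c.symm)
  src_inv p := (P.src_lact _).trans (ℋ.src_inv _)
  tgt_inv p := (P.tgt_ract _).trans (𝒢.tgt_inv _)
  inv_mul := by
    rintro ⟨g, h, c⟩ e
    have d0 : ℋ.tgt (ℋ.inv h) = 𝒢.src (𝒢.inv g) := by
      rw [ℋ.tgt_inv, 𝒢.src_inv]; exact c.symm
    have d1 : ℋ.tgt (P.ract ⟨ℋ.inv h, 𝒢.inv g, d0⟩) = 𝒢.src g := e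
    have d2 : ℋ.tgt (P.ract ⟨ℋ.inv h, 𝒢.inv g, d0⟩) = 𝒢.src (𝒢.inv (𝒢.inv g)) := by
      rw [𝒢.inv_inv]; exact d1
    have d3 : 𝒢.tgt (𝒢.inv g) = 𝒢.src g := 𝒢.tgt_inv g
    have d4 : ℋ.tgt (ℋ.inv h) = 𝒢.src (𝒢.mul ⟨𝒢.inv g, g, d3⟩) := by
      rw [𝒢.src_mul]; exact d0
    have d5 : P.lact ⟨P.ract ⟨ℋ.inv h, 𝒢.inv g, d0⟩, g, d1⟩ =
        𝒢.inv (P.lact ⟨ℋ.inv h, 𝒢.inv g, d0⟩) := by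
      rw [P.inv_lact (e' := d2)]; exact P.lact_congr rfl (𝒢.inv_inv g).symm
    have d7 : ℋ.tgt (ℋ.inv h) = 𝒢.src (𝒢.unit (𝒢.tgt (𝒢.inv (𝒢.inv g)))) := by
      rw [𝒢.inv_inv, 𝒢.src_unit, ℋ.tgt_inv, c]
    have d6 : P.ract ⟨P.ract ⟨ℋ.inv h, 𝒢.inv g, d0⟩, g, d1⟩ = ℋ.inv h := by
      rw [← P.ract_mul (ℋ.inv h) (𝒢.inv g) g d0 d3 d4 d1]
      refine (P.ract_congr rfl (𝒢.inv_mul g d3) (h' := by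
        rw [𝒢.src_unit, ℋ.tgt_inv, c])).trans (P.ract_unit' ?_)
      rw [ℋ.tgt_inv, c]
    refine FiberProduct.ext ?_ ?_
    · refine (𝒢.mul_congr rfl d5 (h' := (𝒢.src_inv _).symm)).trans ?_
      rw [𝒢.mul_inv, P.src_lact, ℋ.src_inv]
      rfl
    · refine (ℋ.mul_congr d6 rfl (h' := ℋ.tgt_inv h)).trans ?_
      rw [ℋ.inv_mul]
      rfl
  mul_inv := by
    rintro ⟨g, h, c⟩ e
    have d0 : ℋ.tgt (ℋ.inv h) = 𝒢.src (𝒢.inv g) := by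
      rw [ℋ.tgt_inv, 𝒢.src_inv]; exact c.symm
    have d1 : ℋ.tgt h = 𝒢.src (P.lact ⟨ℋ.inv h, 𝒢.inv g, d0⟩) := e
    have d2 : ℋ.tgt h = ℋ.src (ℋ.inv h) := (ℋ.src_inv h).symm
    have d3 : ℋ.tgt (ℋ.mul ⟨h, ℋ.inv h, d2⟩) = 𝒢.src (𝒢.inv g) := by
      rw [ℋ.tgt_mul]; exact d0
    have d4 : P.lact ⟨h, P.lact ⟨ℋ.inv h, 𝒢.inv g, d0⟩, d1⟩ = 𝒢.inv g := by
      rw [← P.mul_lact h (ℋ.inv h) (𝒢.inv g) d2 d0 d3 d1]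
      refine (P.lact_congr (ℋ.mul_inv h d2) rfl (h' := by
        rw [ℋ.tgt_unit, 𝒢.src_inv, c])).trans (P.unit_lact' ?_)
      rw [𝒢.src_inv, c]
    have d5 : P.ract ⟨h, P.lact ⟨ℋ.inv h, 𝒢.inv g, d0⟩, d1⟩ =
        ℋ.inv (P.ract ⟨ℋ.inv h, 𝒢.inv g, d0⟩) := by
      rw [P.inv_ract (e' := by rw [ℋ.inv_inv]; exact d1)]
      exact P.ract_congr (ℋ.inv_inv h).symm rfl
    refine FiberProduct.ext ?_ ?_
    · refine (𝒢.mul_congr rfl d4 (h' := (𝒢.src_inv g).symm)).trans ?_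
      rw [𝒢.mul_inv]
      rfl
    · refine (ℋ.mul_congr d5 rfl (h' := ℋ.tgt_inv _)).trans ?_
      rw [ℋ.inv_mul, P.tgt_ract, 𝒢.tgt_inv]
      rfl

end MatchedPair

end Groupoid

section Dynamics

variable {EB B EG G EH H : Type*}
  [NormedAddCommGroup EB] [NormedSpace ℝ EB] [NormedAddCommGroup EG] [NormedSpace ℝ EG]
  [NormedAddCommGroup EH] [NormedSpace ℝ EH]
  [TopologicalSpace B] [ChartedSpace EB B] [IsManifold 𝓘(ℝ, EB) ∞ B]
  [TopologicalSpace G] [ChartedSpace EG G] [IsManifold 𝓘(ℝ, EG) ∞ G]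
  [TopologicalSpace H] [ChartedSpace EH H] [IsManifold 𝓘(ℝ, EH) ∞ H]

theorem mfderiv_congr_apply {E₁ E₂ M₁ M₂ : Type*} [NormedAddCommGroup E₁] [NormedSpace ℝ E₁]
    [NormedAddCommGroup E₂] [NormedSpace ℝ E₂] [TopologicalSpace M₁] [ChartedSpace E₁ M₁]
    [TopologicalSpace M₂] [ChartedSpace E₂ M₂] (u : M₁ → M₂) {x x' : M₁} (h : x = x') (v : E₁) :
    (mfderiv 𝓘(ℝ, E₁) 𝓘(ℝ, E₂) u x v : E₂) = mfderiv 𝓘(ℝ, E₁) 𝓘(ℝ, E₂) u x' v := by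
  subst h; rfl

theorem mfderiv_comp_apply_eq {E₁ E₂ E₃ M₁ M₂ M₃ : Type*} [NormedAddCommGroup E₁]
    [NormedSpace ℝ E₁] [NormedAddCommGroup E₂] [NormedSpace ℝ E₂] [NormedAddCommGroup E₃]
    [NormedSpace ℝ E₃] [TopologicalSpace M₁] [ChartedSpace E₁ M₁] [TopologicalSpace M₂]
    [ChartedSpace E₂ M₂] [TopologicalSpace M₃] [ChartedSpace E₃ M₃] {u : M₁ → M₂} {w : M₂ → M₃}
    {t : M₁ → M₃} (hw : ContMDiff 𝓘(ℝ, E₂) 𝓘(ℝ, E₃) ∞ w) (hu : ContMDiff 𝓘(ℝ, E₁) 𝓘(ℝ, E₂) ∞ u)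
    (h : ∀ y, w (u y) = t y) (x : M₁) (v : E₁) :
    (mfderiv 𝓘(ℝ, E₂) 𝓘(ℝ, E₃) w (u x) (mfderiv 𝓘(ℝ, E₁) 𝓘(ℝ, E₂) u x v) : E₃) =
      mfderiv 𝓘(ℝ, E₁) 𝓘(ℝ, E₃) t x v := by
  obtain rfl : w ∘ u = t := funext h
  exact (congrArg (fun T : E₁ →L[ℝ] E₃ => T v) (mfderiv_comp x
    (hw.contMDiffAt.mdifferentiableAt (by simp)) (hu.contMDiffAt.mdifferentiableAt (by simp)))).symm

namespace LieGroupoid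

variable (𝒢 : LieGroupoid EB B EG G)

/-- The fibre `A_b 𝒢 = ker T_{ε(b)} α` of the Lie algebroid of `𝒢`. -/
def algFiber (b : B) : Submodule ℝ (TangentSpace 𝓘(ℝ, EG) (𝒢.unit b)) :=
  LinearMap.ker (mfderiv 𝓘(ℝ, EG) 𝓘(ℝ, EB) 𝒢.src (𝒢.unit b)).toLinearMap

theorem mfderiv_src_of_mem {b : B} (X : 𝒢.algFiber b) :
    mfderiv 𝓘(ℝ, EG) 𝓘(ℝ, EB) 𝒢.src (𝒢.unit b) X = 0 := X.2

/-- A smooth section of the Lie algebroid `A𝒢`, i.e. a smooth map `B → T𝒢` with value at `b` in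
`A_b 𝒢 ⊆ T_{ε(b)} 𝒢`. -/
structure AlgSection where
  toFun : ∀ b, 𝒢.algFiber b
  smooth : ContMDiff 𝓘(ℝ, EB) 𝓘(ℝ, EG).tangent ∞
    (fun b => (⟨𝒢.unit b, (toFun b).1⟩ : TangentBundle 𝓘(ℝ, EG) G))

instance : CoeFun 𝒢.AlgSection fun _ => ∀ b, 𝒢.algFiber b := ⟨AlgSection.toFun⟩

/-- The derivative `T inv X`, tangent to the curve `x_t⁻¹` when `X` is tangent to `x_t`. -/
def tangentInv {b : B} (X : 𝒢.algFiber b) : TangentSpace 𝓘(ℝ, EG) (𝒢.inv (𝒢.unit b)) :=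
  mfderiv 𝓘(ℝ, EG) 𝓘(ℝ, EG) 𝒢.inv (𝒢.unit b) X

theorem mfderiv_tgt_tangentInv {b : B} (X : 𝒢.algFiber b) :
    mfderiv 𝓘(ℝ, EG) 𝓘(ℝ, EB) 𝒢.tgt (𝒢.inv (𝒢.unit b)) (𝒢.tangentInv X) = 0 :=
  (mfderiv_comp_apply_eq 𝒢.tgt_submersion.contMDiff 𝒢.inv_smooth 𝒢.tgt_inv (𝒢.unit b) X.1).trans
    (𝒢.mfderiv_src_of_mem X)

/-- The value at `g`, where `β g = b`, of the left invariant vector field of `X ∈ A_b 𝒢`: it is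
`T ℓ_g X`, the derivative of `g x_t` for `x_t` in the `α`-fibre over `b`, tangent to `X`. -/
def leftInv (g : G) {b : B} (hb : 𝒢.tgt g = b) (X : 𝒢.algFiber b) : TangentSpace 𝓘(ℝ, EG) g :=
  (mfderiv 𝓘(ℝ, EG × 𝒢.src_submersion.complement) 𝓘(ℝ, EG) 𝒢.mul
    ⟨g, 𝒢.unit b, by rw [𝒢.src_unit, hb]⟩
    (FiberProduct.tangentMk _ 0 X.1 ((map_zero _).trans (𝒢.mfderiv_src_of_mem X).symm)) : EG)

/-- The value at `g`, where `α g = b`, of the right invariant vector field of `X ∈ A_b 𝒢`: it is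
`- T r_g (T inv X)`, the derivative of `- x_t⁻¹ g`. -/
def rightInv (g : G) {b : B} (hb : 𝒢.src g = b) (X : 𝒢.algFiber b) : TangentSpace 𝓘(ℝ, EG) g :=
  (-(mfderiv 𝓘(ℝ, EG × 𝒢.src_submersion.complement) 𝓘(ℝ, EG) 𝒢.mul
    ⟨𝒢.inv (𝒢.unit b), g, by rw [𝒢.tgt_inv, 𝒢.src_unit, hb]⟩
    (FiberProduct.tangentMk _ (𝒢.tangentInv X) 0
      ((𝒢.mfderiv_tgt_tangentInv X).trans (map_zero _).symm))) : EG)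

/-- The derivative `V(L)` of a function along a tangent vector. -/
def deriv (_𝒢 : LieGroupoid EB B EG G) (L : G → ℝ) (g : G) (V : TangentSpace 𝓘(ℝ, EG) g) : ℝ :=
  mfderiv 𝓘(ℝ, EG) 𝓘(ℝ, ℝ) L g V

/-- The discrete Euler-Lagrange equations of `L` at a composable pair `(g₁, g₂)`: the left invariant
field at `g₁` and the right invariant field at `g₂` give the same derivative of `L`, for every
section of the Lie algebroid. -/
def DiscreteEulerLagrange (L : G → ℝ) (g₁ g₂ : G) : Prop :=
  𝒢.tgt g₁ = 𝒢.src g₂ ∧ ∀ X : 𝒢.AlgSection,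
    𝒢.deriv L g₁ (𝒢.leftInv g₁ rfl (X (𝒢.tgt g₁))) -
      𝒢.deriv L g₂ (𝒢.rightInv g₂ rfl (X (𝒢.src g₂))) = 0

end LieGroupoid

namespace MatchedPair

variable {𝒢 : LieGroupoid EB B EG G} {ℋ : LieGroupoid EB B EH H} (P : MatchedPair 𝒢 ℋ)

/-- For `β h = b` and `X ∈ A_b 𝒢` tangent to `x_t`, the tangent vector at `(h, ε(b))` of the curve
`(h, x_t)`. -/
def lineX (h : H) {b : B} (hb : ℋ.tgt h = b) (X : 𝒢.algFiber b) :
    TangentSpace 𝓘(ℝ, EH × 𝒢.src_submersion.complement)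
      (⟨h, 𝒢.unit b, by rw [𝒢.src_unit, hb]⟩ :
        FiberProduct ℋ.tgt_submersion.contMDiff 𝒢.src_submersion) :=
  FiberProduct.tangentMk _ 0 X.1 ((map_zero _).trans (𝒢.mfderiv_src_of_mem X).symm)

/-- For `α g = b` and `Y ∈ A_b ℋ` tangent to `y_t`, the tangent vector at `(ε(b)⁻¹, g)` of the curve
`(y_t⁻¹, g)`. -/
def lineY (g : G) {b : B} (hb : 𝒢.src g = b) (Y : ℋ.algFiber b) :
    TangentSpace 𝓘(ℝ, EH × 𝒢.src_submersion.complement)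
      (⟨ℋ.inv (ℋ.unit b), g, by rw [ℋ.tgt_inv, ℋ.src_unit, hb]⟩ :
        FiberProduct ℋ.tgt_submersion.contMDiff 𝒢.src_submersion) :=
  FiberProduct.tangentMk _ (ℋ.tangentInv Y) 0
    ((ℋ.mfderiv_tgt_tangentInv Y).trans (map_zero _).symm)

theorem lactAlg_aux (h : H) {b : B} (hb : ℋ.tgt h = b) (X : 𝒢.algFiber b) :
    (mfderiv 𝓘(ℝ, EG) 𝓘(ℝ, EB) 𝒢.src (𝒢.unit (ℋ.src h))
      (mfderiv 𝓘(ℝ, EH × 𝒢.src_submersion.complement) 𝓘(ℝ, EG) P.lact _ (lineX h hb X) : EG) : EB) =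
      0 := by
  have e1 := mfderiv_congr_apply (E₁ := EG) (E₂ := EB) 𝒢.src (P.lact_unit (h := h) hb
    (e := by rw [𝒢.src_unit, hb])).symm
    (mfderiv 𝓘(ℝ, EH × 𝒢.src_submersion.complement) 𝓘(ℝ, EG) P.lact _ (lineX h hb X) : EG)
  have e2 := mfderiv_comp_apply_eq (t := fun p => ℋ.src p.fst) 𝒢.src_submersion.contMDiff
    P.lact_smooth P.src_lact ⟨h, 𝒢.unit b, by rw [𝒢.src_unit, hb]⟩ (lineX h hb X)
  have e3 := mfderiv_comp_apply_eq (u := FiberProduct.fst (hf := ℋ.tgt_submersion.contMDiff)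
    (hg := 𝒢.src_submersion)) (t := fun p => ℋ.src p.fst) ℋ.src_submersion.contMDiff
    FiberProduct.contMDiff_fst (fun _ => rfl) ⟨h, 𝒢.unit b, by rw [𝒢.src_unit, hb]⟩ (lineX h hb X)
  refine e1.trans (e2.trans (e3.symm.trans ?_))
  exact (congrArg _ (FiberProduct.mfderiv_fst_tangentMk _ _ _ _)).trans (map_zero _)

/-- `h ▷ X ∈ A_{α h} 𝒢`, the derivative of `h ▷ x_t`. -/
def lactAlg (h : H) {b : B} (hb : ℋ.tgt h = b) (X : 𝒢.algFiber b) : 𝒢.algFiber (ℋ.src h) :=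
  ⟨(mfderiv 𝓘(ℝ, EH × 𝒢.src_submersion.complement) 𝓘(ℝ, EG) P.lact _ (lineX h hb X) : EG),
    P.lactAlg_aux h hb X⟩

/-- `X†(h) = h ◁ X ∈ T_h ℋ`, the derivative of `h ◁ x_t`. -/
def daggerX (h : H) {b : B} (hb : ℋ.tgt h = b) (X : 𝒢.algFiber b) : TangentSpace 𝓘(ℝ, EH) h :=
  (mfderiv 𝓘(ℝ, EH × 𝒢.src_submersion.complement) 𝓘(ℝ, EH) P.ract _ (lineX h hb X) : EH)

/-- `Y†(g) ∈ T_g 𝒢`, the derivative of `y_t⁻¹ ▷ g`. -/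
def daggerY (g : G) {b : B} (hb : 𝒢.src g = b) (Y : ℋ.algFiber b) : TangentSpace 𝓘(ℝ, EG) g :=
  (mfderiv 𝓘(ℝ, EH × 𝒢.src_submersion.complement) 𝓘(ℝ, EG) P.lact _ (lineY g hb Y) : EG)

theorem ractAlg_aux (g : G) {b : B} (hb : 𝒢.src g = b) (Y : ℋ.algFiber b) :
    (mfderiv 𝓘(ℝ, EH) 𝓘(ℝ, EB) ℋ.src (ℋ.unit (𝒢.tgt g))
      (mfderiv 𝓘(ℝ, EH) 𝓘(ℝ, EH) ℋ.inv _ (mfderiv 𝓘(ℝ, EH × 𝒢.src_submersion.complement) 𝓘(ℝ, EH)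
        P.ract _ (lineY g hb Y)) : EH) : EB) = 0 := by
  have e0 : ℋ.unit (𝒢.tgt g) = ℋ.inv (P.ract ⟨ℋ.inv (ℋ.unit b), g, by
      rw [ℋ.tgt_inv, ℋ.src_unit, hb]⟩) := by
    rw [P.ract_congr (ℋ.inv_unit b) rfl (h' := by rw [ℋ.tgt_unit, hb]), P.unit_ract hb, ℋ.inv_unit]
  have e1 := mfderiv_congr_apply (E₁ := EH) (E₂ := EB) ℋ.src e0
    (mfderiv 𝓘(ℝ, EH) 𝓘(ℝ, EH) ℋ.inv _ (mfderiv 𝓘(ℝ, EH × 𝒢.src_submersion.complement) 𝓘(ℝ, EH)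
        P.ract _ (lineY g hb Y)) : EH)
  have e2 := mfderiv_comp_apply_eq (t := ℋ.tgt) ℋ.src_submersion.contMDiff ℋ.inv_smooth ℋ.src_inv
    (P.ract ⟨ℋ.inv (ℋ.unit b), g, by rw [ℋ.tgt_inv, ℋ.src_unit, hb]⟩)
    (mfderiv 𝓘(ℝ, EH × 𝒢.src_submersion.complement) 𝓘(ℝ, EH) P.ract _ (lineY g hb Y))
  have e3 := mfderiv_comp_apply_eq (t := fun p => 𝒢.tgt p.snd) ℋ.tgt_submersion.contMDiff
    P.ract_smooth P.tgt_ract ⟨ℋ.inv (ℋ.unit b), g, by rw [ℋ.tgt_inv, ℋ.src_unit, hb]⟩ (lineY g hb Y)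
  have e4 := mfderiv_comp_apply_eq (u := FiberProduct.snd (hf := ℋ.tgt_submersion.contMDiff)
    (hg := 𝒢.src_submersion)) (t := fun p => 𝒢.tgt p.snd) 𝒢.tgt_submersion.contMDiff
    FiberProduct.contMDiff_snd (fun _ => rfl) ⟨ℋ.inv (ℋ.unit b), g, by rw [ℋ.tgt_inv, ℋ.src_unit, hb]⟩
    (lineY g hb Y)
  refine e1.trans (e2.trans (e3.trans (e4.symm.trans ?_)))
  exact (congrArg _ (FiberProduct.mfderiv_snd_tangentMk _ _ _ _)).trans (map_zero _)

/-- `Y ◁ g ∈ A_{β g} ℋ`, the derivative of `(y_t⁻¹ ◁ g)⁻¹`. -/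
def ractAlg (g : G) {b : B} (hb : 𝒢.src g = b) (Y : ℋ.algFiber b) : ℋ.algFiber (𝒢.tgt g) :=
  ⟨(mfderiv 𝓘(ℝ, EH) 𝓘(ℝ, EH) ℋ.inv _ (mfderiv 𝓘(ℝ, EH × 𝒢.src_submersion.complement) 𝓘(ℝ, EH)
    P.ract _ (lineY g hb Y)) : EH), P.ractAlg_aux g hb Y⟩

/-- The vector `T(ε_ℋ ∘ β)(X) + Y` of `T_{ε(b)} ℋ`, for `X ∈ A_b 𝒢` and `Y ∈ A_b ℋ`. -/
def combineSnd (ℋ : LieGroupoid EB B EH H) {b : B} (X : 𝒢.algFiber b) (Y : ℋ.algFiber b) :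
    TangentSpace 𝓘(ℝ, EH) (ℋ.unit b) :=
  let v : EH := mfderiv 𝓘(ℝ, EG) 𝓘(ℝ, EH) (ℋ.unit ∘ 𝒢.tgt) (𝒢.unit b) X.1
  let w : EH := Y.1
  v + w

theorem mfderiv_src_combineSnd {b : B} (X : 𝒢.algFiber b) (Y : ℋ.algFiber b) :
    (mfderiv 𝓘(ℝ, EG) 𝓘(ℝ, EB) 𝒢.tgt (𝒢.unit b) X.1 : EB) =
      mfderiv 𝓘(ℝ, EH) 𝓘(ℝ, EB) ℋ.src (ℋ.unit b) (combineSnd ℋ X Y) := by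
  let v : EH := mfderiv 𝓘(ℝ, EG) 𝓘(ℝ, EH) (ℋ.unit ∘ 𝒢.tgt) (𝒢.unit b) X.1
  let D : EH →L[ℝ] EB := mfderiv 𝓘(ℝ, EH) 𝓘(ℝ, EB) ℋ.src (ℋ.unit b)
  have e1 : D (combineSnd ℋ X Y) = D v + D Y.1 := D.map_add _ _
  have e2 : D Y.1 = 0 := ℋ.mfderiv_src_of_mem Y
  have e3 := mfderiv_congr_apply (E₁ := EH) (E₂ := EB) ℋ.src
    (congrArg ℋ.unit (𝒢.tgt_unit b)).symm v
  have e4 := mfderiv_comp_apply_eq (t := 𝒢.tgt) ℋ.src_submersion.contMDiff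
    (ℋ.unit_smooth.comp 𝒢.tgt_submersion.contMDiff) (fun x => ℋ.src_unit (𝒢.tgt x)) (𝒢.unit b) X.1
  have e5 : D (combineSnd ℋ X Y) = D v := e1.trans ((congrArg (D v + ·) e2).trans (add_zero _))
  exact (e3.trans e4).symm.trans e5.symm

/-- The element `(X, T(ε_ℋ ∘ β)(X) + Y)` of `A_b (𝒢 ⋈ ℋ)` corresponding to `X ∈ A_b 𝒢` and
`Y ∈ A_b ℋ`. -/
def combine {b : B} (X : 𝒢.algFiber b) (Y : ℋ.algFiber b) : P.groupoid.algFiber b :=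
  ⟨FiberProduct.tangentMk (P.arrowUnit b) X.1 (combineSnd ℋ X Y) (mfderiv_src_combineSnd X Y),
    (mfderiv_comp_apply_eq (u := FiberProduct.fst (hf := 𝒢.tgt_submersion.contMDiff)
      (hg := ℋ.src_submersion)) (t := P.arrowSrc) 𝒢.src_submersion.contMDiff
      FiberProduct.contMDiff_fst (fun _ => rfl) (P.arrowUnit b) _).symm.trans
      ((congrArg _ (FiberProduct.mfderiv_fst_tangentMk _ _ _ _)).trans
        (𝒢.mfderiv_src_of_mem X))⟩

/-- `Lt` is a smooth extension of `L : 𝒢 ⋈ ℋ → ℝ` to a neighbourhood of `p` in `𝒢 × ℋ`. -/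
def IsLocalExtension (L : P.Arrow → ℝ) (p : P.Arrow) (Lt : G × H → ℝ) : Prop :=
  ContMDiffAt (𝓘(ℝ, EG).prod 𝓘(ℝ, EH)) 𝓘(ℝ, ℝ) ∞ Lt p.incl ∧ ∀ᶠ q in 𝓝 p, Lt q.incl = L q

/-- The derivative `V(L)` at `p = (g, h)` along `V ∈ T_g 𝒢`, in the `𝒢`-variable. -/
def deriv₁ (Lt : G × H → ℝ) (p : P.Arrow) (V : TangentSpace 𝓘(ℝ, EG) p.fst) : ℝ :=
  mfderiv (𝓘(ℝ, EG).prod 𝓘(ℝ, EH)) 𝓘(ℝ, ℝ) Lt p.incl (V, (0 : EH))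

/-- The derivative `W(L)` at `p = (g, h)` along `W ∈ T_h ℋ`, in the `ℋ`-variable. -/
def deriv₂ (Lt : G × H → ℝ) (p : P.Arrow) (W : TangentSpace 𝓘(ℝ, EH) p.snd) : ℝ :=
  mfderiv (𝓘(ℝ, EG).prod 𝓘(ℝ, EH)) 𝓘(ℝ, ℝ) Lt p.incl ((0 : EG), W)

/-- The expression
`←(h ▷ X)(g)(L) - →X(g')(L) + Y†(g')(L) + X†(h)(L) + ←Y(h)(L) - →(Y ◁ g')(h')(L)`
for `p = (g, h)` and `q = (g', h')` with `β h = b = α g'`, and for `X ∈ A_b 𝒢`, `Y ∈ A_b ℋ`. The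
derivatives at `p` and at `q` are those of the extensions `Lp` and `Lq` of `L`. -/
def splitExpr (Lp Lq : G × H → ℝ) (p q : P.Arrow) {b : B} (hp : ℋ.tgt p.snd = b)
    (hq : 𝒢.src q.fst = b) (X : 𝒢.algFiber b) (Y : ℋ.algFiber b) : ℝ :=
  P.deriv₁ Lp p (𝒢.leftInv p.fst p.condition (P.lactAlg p.snd hp X)) -
    P.deriv₁ Lq q (𝒢.rightInv q.fst hq X) +
    P.deriv₁ Lq q (P.daggerY q.fst hq Y) +
    P.deriv₂ Lp p (P.daggerX p.snd hp X) +
    P.deriv₂ Lp p (ℋ.leftInv p.snd hp Y) -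
    P.deriv₂ Lq q (ℋ.rightInv q.snd q.condition.symm (P.ractAlg q.fst hq Y))

end MatchedPair

end Dynamics

end

/-! The identity is the chain rule applied to the product `(g, h)(g', h') = (g (h ▷ g'), (h ◁ g')
h')`, one component at a time. A tangent vector of `𝒢 ⋈ ℋ` is determined by its two components, and
near a point `L` is an extension composed with the inclusion in `𝒢 × ℋ`. Hence `V(L)` is the sum of
the derivatives of the extension along the two components of `V` (`deriv_eq_deriv₁_add_deriv₂`), and
it remains to find the components of `←U` and `→U`.

The correction terms come from the unit laws. Differentiating `g ε(β g) = g` gives `T mul (u, T(ε ∘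
β) u) = u`, so by linearity `T mul (u, T(ε ∘ β) u + Y) = u + ←Y`; symmetrically `T mul (T inv X +
T(ε ∘ α) u, u) = u - →X`.

For `←U` at `(g, h)`, the first component is `T mul (0, h ▷ X) = ←(h ▷ X)`. The second is `T mul
(X†(h), T(ε ∘ β) X + Y)`; since `β (h ◁ g') = β g'`, the vectors `X†(h)` and `X` have the same image
under `Tβ`, and the unit law with `u = X†(h)` gives `X†(h) + ←Y(h)`.

For `→U` at `(g', h')`, the vector `T inv U` has components `T inv X + T(ε ∘ β) Y` and `T inv Y`.
Since `α (h ▷ g) = α h`, one has `Tα Y† = Tβ Y`, and the unit law with `u = Y†(g')` gives the first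
component `→X - Y†`. The second is `→(Y ◁ g')`, because `T inv (Y ◁ g')` is the derivative of `y_t⁻¹
◁ g'`. The lemmas are `dfst_leftVec`, `dsnd_leftVec`, `dfst_rightVec` and `dsnd_rightVec`.

For the second claim, `(X, Y) ↦ U` is a fibrewise bijection which, like its inverse, is built from
tangent maps of smooth maps and linear combinations. Smooth sections therefore correspond to pairs
of smooth sections. -/

set_option linter.unusedSectionVars false

noncomputable section

/-! ### Derivatives compared at propositionally equal base points. -/

section TangentMaps

variable {E₁ E₂ E₃ M₁ M₂ M₃ : Type*}
  [NormedAddCommGroup E₁] [NormedSpace ℝ E₁] [NormedAddCommGroup E₂] [NormedSpace ℝ E₂]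
  [NormedAddCommGroup E₃] [NormedSpace ℝ E₃]
  [TopologicalSpace M₁] [ChartedSpace E₁ M₁] [TopologicalSpace M₂] [ChartedSpace E₂ M₂]
  [TopologicalSpace M₃] [ChartedSpace E₃ M₃]

/-- The manifold derivative as a continuous linear map between the model spaces. Since the type does
not mention the base points, values at propositionally equal points can be compared. -/
def fderivModel (u : M₁ → M₂) (x : M₁) : E₁ →L[ℝ] E₂ :=
  mfderiv 𝓘(ℝ, E₁) 𝓘(ℝ, E₂) u x

/-- The composite `t` and the intermediate point `x'` are free up to proved equalities, so an
algebraic identity of the groupoid can be passed as `h` and differentiated in one rewrite. -/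
theorem fderivModel_comp {w : M₂ → M₃} {u : M₁ → M₂} (hw : ContMDiff 𝓘(ℝ, E₂) 𝓘(ℝ, E₃) ∞ w)
    (hu : ContMDiff 𝓘(ℝ, E₁) 𝓘(ℝ, E₂) ∞ u) {t : M₁ → M₃} (h : ∀ y, w (u y) = t y)
    {x : M₁} {x' : M₂} (hx : u x = x') (v : E₁) :
    fderivModel w x' (fderivModel u x v : E₂) = (fderivModel t x v : E₃) := by
  subst hx
  exact mfderiv_comp_apply_eq hw hu h x v

theorem fderivModel_of_eq_id {u : M₁ → M₁} (h : ∀ y, u y = y) (x : M₁) (v : E₁) :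
    (fderivModel u x v : E₁) = v := by
  obtain rfl : u = id := funext h
  exact congrArg (fun T : E₁ →L[ℝ] E₁ => T v) (mfderiv_id (I := 𝓘(ℝ, E₁)) (x := x))

end TangentMaps

/-! ### Differential calculus on fibre products, by components. -/

namespace FiberProduct

variable {EM EN EB EP EQ M N B P Q : Type*}
  [NormedAddCommGroup EM] [NormedSpace ℝ EM] [NormedAddCommGroup EN] [NormedSpace ℝ EN]
  [NormedAddCommGroup EB] [NormedSpace ℝ EB] [NormedAddCommGroup EP] [NormedSpace ℝ EP]
  [NormedAddCommGroup EQ] [NormedSpace ℝ EQ]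
  [TopologicalSpace M] [ChartedSpace EM M] [TopologicalSpace N] [ChartedSpace EN N]
  [TopologicalSpace B] [ChartedSpace EB B] [TopologicalSpace P] [ChartedSpace EP P]
  [TopologicalSpace Q] [ChartedSpace EQ Q] [IsManifold 𝓘(ℝ, EM) ∞ M]
  {f : M → B} {g : N → B}
  {hf : ContMDiff 𝓘(ℝ, EM) 𝓘(ℝ, EB) ∞ f} {hg : IsSubmersion 𝓘(ℝ, EN) 𝓘(ℝ, EB) ∞ g}

theorem mfderiv_incl_apply (p : FiberProduct hf hg) (v : EM × hg.complement) :
    (mfderiv 𝓘(ℝ, EM × hg.complement) (𝓘(ℝ, EM).prod 𝓘(ℝ, EN)) incl p v : EM × EN) =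
      (fderivModel (fst : FiberProduct hf hg → M) p v,
        fderivModel (snd : FiberProduct hf hg → N) p v) := by
  have hi := ((contMDiff_incl.contMDiffAt (x := p)).mdifferentiableAt (by simp)).hasMFDerivAt
  have h1 := ((hasMFDerivAt_fst (I := 𝓘(ℝ, EM)) (I' := 𝓘(ℝ, EN)) p.incl).comp p hi).mfderiv
  have h2 := ((hasMFDerivAt_snd (I := 𝓘(ℝ, EM)) (I' := 𝓘(ℝ, EN)) p.incl).comp p hi).mfderiv
  exact Prod.ext
    (congrArg (fun T : EM × hg.complement →L[ℝ] EM => T v) h1).symm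
    (congrArg (fun T : EM × hg.complement →L[ℝ] EN => T v) h2).symm

/-- A tangent vector of the fibre product is determined by its two components. -/
theorem tangent_ext_components (p : FiberProduct hf hg) {v w : EM × hg.complement}
    (h₁ : (fderivModel (fst : FiberProduct hf hg → M) p v : EM) = fderivModel fst p w)
    (h₂ : (fderivModel (snd : FiberProduct hf hg → N) p v : EN) = fderivModel snd p w) :
    v = w :=
  tangent_ext p (((mfderiv_incl_apply p v).trans (Prod.ext h₁ h₂)).trans
    (mfderiv_incl_apply p w).symm)

/-- The vector `tangentMk p v w` as an element of the model space. -/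
def tangentPair (p : FiberProduct hf hg) (v : EM) (w : EN)
    (h : (fderivModel f p.fst v : EB) = fderivModel g p.snd w) : EM × hg.complement :=
  tangentMk p v w h

theorem fderivModel_fst_tangentPair (p : FiberProduct hf hg) (v : EM) (w : EN)
    (h : (fderivModel f p.fst v : EB) = fderivModel g p.snd w) :
    (fderivModel (fst : FiberProduct hf hg → M) p (tangentPair p v w h) : EM) = v :=
  mfderiv_fst_tangentMk p v w h

theorem fderivModel_snd_tangentPair (p : FiberProduct hf hg) (v : EM) (w : EN)
    (h : (fderivModel f p.fst v : EB) = fderivModel g p.snd w) :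
    (fderivModel (snd : FiberProduct hf hg → N) p (tangentPair p v w h) : EN) = w :=
  mfderiv_snd_tangentMk p v w h

theorem tangentPair_add (p : FiberProduct hf hg) {v v' : EM} {w w' : EN}
    (h : (fderivModel f p.fst v : EB) = fderivModel g p.snd w)
    (h' : (fderivModel f p.fst v' : EB) = fderivModel g p.snd w')
    (h'' : (fderivModel f p.fst (v + v') : EB) = fderivModel g p.snd (w + w')) :
    tangentPair p (v + v') (w + w') h'' = tangentPair p v w h + tangentPair p v' w' h' := by
  apply tangent_ext_components p
  · rw [map_add]; simp only [fderivModel_fst_tangentPair]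
  · rw [map_add]; simp only [fderivModel_snd_tangentPair]

/-- The derivative of a smooth map into the fibre product, in terms of its components. -/
theorem fderivModel_eq_tangentPair {A : Q → FiberProduct hf hg}
    (hA : ContMDiff 𝓘(ℝ, EQ) 𝓘(ℝ, EM × hg.complement) ∞ A)
    {x : Q} {V : EQ} {p : FiberProduct hf hg} (hp : A x = p) {v : EM} {w : EN}
    (hv : (fderivModel (fun y => (A y).fst) x V : EM) = v)
    (hw : (fderivModel (fun y => (A y).snd) x V : EN) = w)
    (h : (fderivModel f p.fst v : EB) = fderivModel g p.snd w) :
    (fderivModel A x V : EM × hg.complement) = tangentPair p v w h := by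
  apply tangent_ext_components p
  · rw [fderivModel_fst_tangentPair, ← hv]
    exact fderivModel_comp contMDiff_fst hA (fun _ => rfl) hp V
  · rw [fderivModel_snd_tangentPair, ← hw]
    exact fderivModel_comp contMDiff_snd hA (fun _ => rfl) hp V

/-- The derivative at `p` of a map `Φ` on the fibre product, applied to the vector with components
`v` and `w`. -/
def fderivPair (Φ : FiberProduct hf hg → P) (p : FiberProduct hf hg) (v : EM) (w : EN)
    (h : (fderivModel f p.fst v : EB) = fderivModel g p.snd w) : EP :=
  fderivModel Φ p (tangentPair p v w h)

theorem fderivPair_add (Φ : FiberProduct hf hg → P) (p : FiberProduct hf hg) {v v' : EM} {w w' : EN}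
    (h : (fderivModel f p.fst v : EB) = fderivModel g p.snd w)
    (h' : (fderivModel f p.fst v' : EB) = fderivModel g p.snd w')
    (h'' : (fderivModel f p.fst (v + v') : EB) = fderivModel g p.snd (w + w')) :
    (fderivPair Φ p (v + v') (w + w') h'' : EP) =
      fderivPair Φ p v w h + fderivPair Φ p v' w' h' := by
  rw [fderivPair, tangentPair_add p h h', map_add]
  rfl

/-- The chain rule for a map which factors through a fibre product. -/
theorem fderivPair_eq {Φ : FiberProduct hf hg → P} {A : Q → FiberProduct hf hg}
    (hΦ : ContMDiff 𝓘(ℝ, EM × hg.complement) 𝓘(ℝ, EP) ∞ Φ)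
    (hA : ContMDiff 𝓘(ℝ, EQ) 𝓘(ℝ, EM × hg.complement) ∞ A)
    {t : Q → P} (ht : ∀ y, Φ (A y) = t y)
    {x : Q} {V : EQ} {p : FiberProduct hf hg} (hp : A x = p) {v : EM} {w : EN}
    (hv : (fderivModel (fun y => (A y).fst) x V : EM) = v)
    (hw : (fderivModel (fun y => (A y).snd) x V : EN) = w)
    (h : (fderivModel f p.fst v : EB) = fderivModel g p.snd w) :
    (fderivPair Φ p v w h : EP) = fderivModel t x V := by
  rw [fderivPair, ← fderivModel_eq_tangentPair hA hp hv hw h]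
  exact fderivModel_comp hΦ hA ht hp V

/-- The compatibility proof depends on the point and on both vectors, which obstructs direct
rewriting; all three are exchanged at once here. -/
theorem fderivPair_congr (Φ : FiberProduct hf hg → P) {p p' : FiberProduct hf hg}
    (hp : p = p') {v v' : EM} (hv : v = v') {w w' : EN} (hw : w = w')
    (h : (fderivModel f p.fst v : EB) = fderivModel g p.snd w)
    (h' : (fderivModel f p'.fst v' : EB) = fderivModel g p'.snd w') :
    (fderivPair Φ p v w h : EP) = fderivPair Φ p' v' w' h' := by
  subst hp hv hw; rfl

end FiberProduct

/-! ### The tangent maps of the product and the inverse of a Lie groupoid. -/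

namespace LieGroupoid

open FiberProduct

variable {EB B EG G : Type*}
  [NormedAddCommGroup EB] [NormedSpace ℝ EB] [NormedAddCommGroup EG] [NormedSpace ℝ EG]
  [TopologicalSpace B] [ChartedSpace EB B] [IsManifold 𝓘(ℝ, EB) ∞ B]
  [TopologicalSpace G] [ChartedSpace EG G] [IsManifold 𝓘(ℝ, EG) ∞ G]
  (𝒢 : LieGroupoid EB B EG G)

/-! Tangent vectors as elements of the model space -/

def vec {b : B} (X : 𝒢.algFiber b) : EG := X.1

def invVec {b : B} (X : 𝒢.algFiber b) : EG := 𝒢.tangentInv X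

def leftVec (g : G) {b : B} (hb : 𝒢.tgt g = b) (X : 𝒢.algFiber b) : EG := 𝒢.leftInv g hb X

def rightVec (g : G) {b : B} (hb : 𝒢.src g = b) (X : 𝒢.algFiber b) : EG := 𝒢.rightInv g hb X

theorem src_smooth : ContMDiff 𝓘(ℝ, EG) 𝓘(ℝ, EB) ∞ 𝒢.src := 𝒢.src_submersion.contMDiff

theorem tgt_smooth : ContMDiff 𝓘(ℝ, EG) 𝓘(ℝ, EB) ∞ 𝒢.tgt := 𝒢.tgt_submersion.contMDiff

/-- `T mul (u, T(ε ∘ β) u + Y) = u + ←Y(g)` -/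
theorem fderivModel_mul_add_unit_tgt {g : G} {b : B} (hb : 𝒢.tgt g = b) (u : EG)
    (Y : 𝒢.algFiber b)
    (h : (fderivModel 𝒢.tgt g u : EB) = fderivModel 𝒢.src (𝒢.unit b)
      ((fderivModel (𝒢.unit ∘ 𝒢.tgt) g u : EG) + 𝒢.vec Y)) :
    fderivPair 𝒢.mul ⟨g, 𝒢.unit b, by rw [𝒢.src_unit, hb]⟩ u _ h =
      u + 𝒢.leftVec g hb Y := by
  -- `mul ∘ A` is the identity by the right unit law, and `T A u` is the pair `(u, T(ε ∘ β) u)`.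
  let A : G → FiberProduct 𝒢.tgt_submersion.contMDiff 𝒢.src_submersion :=
    fun k => ⟨k, 𝒢.unit (𝒢.tgt k), by rw [𝒢.src_unit]⟩
  have hp : A g = ⟨g, 𝒢.unit b, by rw [𝒢.src_unit, hb]⟩ :=
    FiberProduct.ext rfl (congrArg 𝒢.unit hb)
  have hA : ContMDiff 𝓘(ℝ, EG) 𝓘(ℝ, EG × 𝒢.src_submersion.complement) ∞ A :=
    contMDiff_of_components contMDiff_id (𝒢.unit_smooth.comp 𝒢.tgt_smooth)
  have h0 : (fderivModel 𝒢.src (𝒢.unit b) (𝒢.vec Y) : EB) = 0 := 𝒢.mfderiv_src_of_mem Y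
  have h1 : (fderivModel 𝒢.tgt g u : EB) =
      fderivModel 𝒢.src (𝒢.unit b) (fderivModel (𝒢.unit ∘ 𝒢.tgt) g u : EG) := by
    rw [h, map_add, h0, add_zero]
  have h2 : (fderivModel 𝒢.tgt g (0 : EG) : EB) = fderivModel 𝒢.src (𝒢.unit b) (𝒢.vec Y) := by
    rw [h0, map_zero]
  -- The vector splits as `(u, T(ε ∘ β) u) + (0, Y)`. Both summands are tangent to the fibre product
  -- because `Tα Y = 0`, and the second contributes `←Y(g)` by definition.
  have e := fderivPair_add (EP := EG) 𝒢.mul ⟨g, 𝒢.unit b, by rw [𝒢.src_unit, hb]⟩ h1 h2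
    (by rw [add_zero]; exact h)
  simp only [add_zero] at e
  rw [e]
  congr 1
  exact (fderivPair_eq 𝒢.mul_smooth hA (t := id) (fun k => 𝒢.mul_unit k _) hp
    (fderivModel_of_eq_id (fun _ => rfl) g u)
    rfl h1).trans (fderivModel_of_eq_id (fun _ => rfl) g u)

/-- `T mul (T inv X + T(ε ∘ α) u, u) = u - →X(g)` -/
theorem fderivModel_mul_tangentInv_add {g : G} {b : B} (hb : 𝒢.src g = b) (X : 𝒢.algFiber b)
    (u : EG)
    (h : (fderivModel 𝒢.tgt (𝒢.inv (𝒢.unit b)) (𝒢.invVec X +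
      (fderivModel (𝒢.unit ∘ 𝒢.src) g u : EG)) : EB) = fderivModel 𝒢.src g u) :
    fderivPair 𝒢.mul ⟨𝒢.inv (𝒢.unit b), g, by rw [𝒢.tgt_inv, 𝒢.src_unit, hb]⟩ _ u h =
      -𝒢.rightVec g hb X + u := by
  -- Now the left unit law makes `mul ∘ A` the identity, and `T A u` is `(T(ε ∘ α) u, u)`.
  let A : G → FiberProduct 𝒢.tgt_submersion.contMDiff 𝒢.src_submersion :=
    fun k => ⟨𝒢.unit (𝒢.src k), k, by rw [𝒢.tgt_unit]⟩
  have hp : A g = ⟨𝒢.inv (𝒢.unit b), g, by rw [𝒢.tgt_inv, 𝒢.src_unit, hb]⟩ :=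
    FiberProduct.ext ((congrArg 𝒢.unit hb).trans (𝒢.inv_unit b).symm) rfl
  have hA : ContMDiff 𝓘(ℝ, EG) 𝓘(ℝ, EG × 𝒢.src_submersion.complement) ∞ A :=
    contMDiff_of_components (𝒢.unit_smooth.comp 𝒢.src_smooth) contMDiff_id
  have h0 : (fderivModel 𝒢.tgt (𝒢.inv (𝒢.unit b)) (𝒢.invVec X) : EB) = 0 :=
    𝒢.mfderiv_tgt_tangentInv X
  have h1 : (fderivModel 𝒢.tgt (𝒢.inv (𝒢.unit b)) (fderivModel (𝒢.unit ∘ 𝒢.src) g u : EG) : EB) =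
      fderivModel 𝒢.src g u := by
    rw [← h, map_add, h0, zero_add]
  have h2 : (fderivModel 𝒢.tgt (𝒢.inv (𝒢.unit b)) (𝒢.invVec X) : EB) =
      fderivModel 𝒢.src g (0 : EG) := by
    rw [h0, map_zero]
  -- The splitting is `(T inv X, 0) + (T(ε ∘ α) u, u)`, where the first summand is admissible
  -- because `Tβ (T inv X) = 0`. It gives `-→X(g)`, since `→X` carries a minus sign in its
  -- definition.
  have e := fderivPair_add (EP := EG) 𝒢.mul
    ⟨𝒢.inv (𝒢.unit b), g, by rw [𝒢.tgt_inv, 𝒢.src_unit, hb]⟩ h2 h1 (by rw [zero_add]; exact h)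
  simp only [zero_add] at e
  rw [e]
  congr 1
  · exact (neg_neg _).symm
  · exact (fderivPair_eq 𝒢.mul_smooth hA (t := id) (fun k => 𝒢.unit_mul k _) hp rfl
      (fderivModel_of_eq_id (fun _ => rfl) g u) h1).trans (fderivModel_of_eq_id (fun _ => rfl) g u)

/-- `T inv` is an involution. -/
theorem fderivModel_inv_inv {g g' : G} (h : 𝒢.inv g = g') (v : EG) :
    (fderivModel 𝒢.inv g' (fderivModel 𝒢.inv g v : EG) : EG) = v := by
  rw [fderivModel_comp 𝒢.inv_smooth 𝒢.inv_smooth (t := id) 𝒢.inv_inv h]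
  exact fderivModel_of_eq_id (fun _ => rfl) g v

theorem fderivModel_src_vec {b : B} (X : 𝒢.algFiber b) :
    (fderivModel 𝒢.src (𝒢.unit b) (𝒢.vec X) : EB) = 0 :=
  𝒢.mfderiv_src_of_mem X

theorem fderivModel_tgt_invVec {b : B} (X : 𝒢.algFiber b) :
    (fderivModel 𝒢.tgt (𝒢.inv (𝒢.unit b)) (𝒢.invVec X) : EB) = 0 :=
  𝒢.mfderiv_tgt_tangentInv X

theorem fderivModel_src_invVec {b : B} (X : 𝒢.algFiber b) :
    (fderivModel 𝒢.src (𝒢.inv (𝒢.unit b)) (𝒢.invVec X) : EB) =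
      fderivModel 𝒢.tgt (𝒢.unit b) (𝒢.vec X) :=
  fderivModel_comp 𝒢.src_smooth 𝒢.inv_smooth 𝒢.src_inv rfl _

end LieGroupoid

/-! ### Smooth families of tangent vectors along a map. -/

section AlongMaps

variable {EB EM EN B M N : Type*}
  [NormedAddCommGroup EB] [NormedSpace ℝ EB] [NormedAddCommGroup EM] [NormedSpace ℝ EM]
  [NormedAddCommGroup EN] [NormedSpace ℝ EN]
  [TopologicalSpace B] [ChartedSpace EB B]
  [TopologicalSpace M] [ChartedSpace EM M] [IsManifold 𝓘(ℝ, EM) ∞ M]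
  [TopologicalSpace N] [ChartedSpace EN N] [IsManifold 𝓘(ℝ, EN) ∞ N]

/-- The family `s b ∈ T_{σ b} M` of tangent vectors along `σ` is smooth. -/
def SmoothAlong (σ : B → M) (s : B → EM) : Prop :=
  ContMDiff 𝓘(ℝ, EB) 𝓘(ℝ, EM).tangent ∞ (fun b => (⟨σ b, s b⟩ : TangentBundle 𝓘(ℝ, EM) M))

/-- Smoothness can be read in a trivialisation of the tangent bundle, which is linear on fibres. The
scalar `r` serves for sums (`r = 1`) and differences (`r = -1`) alike. -/
theorem SmoothAlong.add_smul {σ : B → M} {s t : B → EM} (hs : SmoothAlong (EB := EB) σ s)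
    (ht : SmoothAlong (EB := EB) σ t) (r : ℝ) :
    SmoothAlong (EB := EB) σ (fun b => s b + r • t b) := by
  intro b
  have h1 := Bundle.contMDiffAt_totalSpace.1 (hs b)
  have h2 := Bundle.contMDiffAt_totalSpace.1 (ht b)
  refine Bundle.contMDiffAt_totalSpace.2 ⟨h1.1, ?_⟩
  have h3 : ContMDiffAt 𝓘(ℝ, EB) 𝓘(ℝ, ℝ) ∞ (fun _ : B => r) b := contMDiffAt_const
  refine (h1.2.add (h3.smul h2.2)).congr_of_eventuallyEq ?_
  let e := trivializationAt EM (TangentSpace 𝓘(ℝ, EM) : M → Type _) (σ b)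
  -- Linearity of the trivialisation holds only over its base set, which `σ x` reaches for `x` near
  -- `b`.
  filter_upwards [h1.1.continuousAt.preimage_mem_nhds (e.open_baseSet.mem_nhds
    (FiberBundle.mem_baseSet_trivializationAt' (σ b)))] with x hx
  have hl := e.linear ℝ (b := σ x) hx
  exact (hl.map_add (s x) (r • t x)).trans (congrArg _ (hl.map_smul r (t x)))

theorem SmoothAlong.map {σ : B → M} {s : B → EM} (hs : SmoothAlong (EB := EB) σ s) {u : M → N}
    (hu : ContMDiff 𝓘(ℝ, EM) 𝓘(ℝ, EN) ∞ u) {τ : B → N} (h : ∀ b, u (σ b) = τ b) :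
    SmoothAlong (EB := EB) τ (fun b => (fderivModel u (σ b) (s b) : EN)) := by
  obtain rfl : u ∘ σ = τ := funext h
  exact (hu.contMDiff_tangentMap (m := ∞) (by simp)).comp hs

end AlongMaps

/-! ### The tangent map of the product of `𝒢 ⋈ ℋ`. -/

namespace MatchedPair

open FiberProduct LieGroupoid

variable {EB B EG G EH H : Type*}
  [NormedAddCommGroup EB] [NormedSpace ℝ EB] [NormedAddCommGroup EG] [NormedSpace ℝ EG]
  [NormedAddCommGroup EH] [NormedSpace ℝ EH]
  [TopologicalSpace B] [ChartedSpace EB B] [IsManifold 𝓘(ℝ, EB) ∞ B]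
  [TopologicalSpace G] [ChartedSpace EG G] [IsManifold 𝓘(ℝ, EG) ∞ G]
  [TopologicalSpace H] [ChartedSpace EH H] [IsManifold 𝓘(ℝ, EH) ∞ H]
  {𝒢 : LieGroupoid EB B EG G} {ℋ : LieGroupoid EB B EH H} (P : MatchedPair 𝒢 ℋ)

/-- The derivatives of the two components of a tangent vector of `𝒢 ⋈ ℋ`. -/
def dfst (p : P.Arrow) : P.Model →L[ℝ] EG := fderivModel (FiberProduct.fst : P.Arrow → G) p

def dsnd (p : P.Arrow) : P.Model →L[ℝ] EH := fderivModel (FiberProduct.snd : P.Arrow → H) p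

/-- The pairs of arrows with `β h = α g`, on which the actions are defined. -/
abbrev ActionPair (_P : MatchedPair 𝒢 ℋ) : Type _ :=
  FiberProduct ℋ.tgt_submersion.contMDiff 𝒢.src_submersion

/-- The composable pairs of `𝒢 ⋈ ℋ`. -/
abbrev Composable : Type _ :=
  FiberProduct P.arrowTgt_submersion.contMDiff P.arrowSrc_submersion

/-- The inner pair `(h, g')` of a composable pair `((g, h), (g', h'))`. -/
def inner (z : P.Composable) : P.ActionPair := ⟨z.fst.snd, z.snd.fst, z.condition⟩

theorem inner_smooth : ContMDiff 𝓘(ℝ, P.Model × P.arrowSrc_submersion.complement)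
    𝓘(ℝ, EH × 𝒢.src_submersion.complement) ∞ P.inner :=
  contMDiff_of_components (contMDiff_snd.comp contMDiff_fst) (contMDiff_fst.comp contMDiff_snd)

theorem fst_fst_smooth : ContMDiff 𝓘(ℝ, P.Model × P.arrowSrc_submersion.complement) 𝓘(ℝ, EG) ∞
    (fun z : P.Composable => z.fst.fst) :=
  FiberProduct.contMDiff_fst.comp FiberProduct.contMDiff_fst

theorem snd_snd_smooth : ContMDiff 𝓘(ℝ, P.Model × P.arrowSrc_submersion.complement) 𝓘(ℝ, EH) ∞
    (fun z : P.Composable => z.snd.snd) :=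
  FiberProduct.contMDiff_snd.comp FiberProduct.contMDiff_snd

variable {P} in
theorem fderivModel_fst_fst {z : P.Composable} {a c : P.Model}
    (h : (fderivModel P.arrowTgt z.fst a : EB) = fderivModel P.arrowSrc z.snd c) :
    (fderivModel (fun z : P.Composable => z.fst.fst) z (tangentPair z a c h) : EG) =
      P.dfst z.fst a := by
  refine (fderivModel_comp (w := FiberProduct.fst) contMDiff_fst contMDiff_fst (fun _ => rfl) rfl
    _).symm.trans ?_
  rw [fderivModel_fst_tangentPair]; rfl

variable {P} in
theorem fderivModel_fst_snd {z : P.Composable} {a c : P.Model}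
    (h : (fderivModel P.arrowTgt z.fst a : EB) = fderivModel P.arrowSrc z.snd c) :
    (fderivModel (fun z : P.Composable => z.fst.snd) z (tangentPair z a c h) : EH) =
      P.dsnd z.fst a := by
  refine (fderivModel_comp (w := FiberProduct.snd) contMDiff_snd contMDiff_fst (fun _ => rfl) rfl
    _).symm.trans ?_
  rw [fderivModel_fst_tangentPair]; rfl

variable {P} in
theorem fderivModel_snd_fst {z : P.Composable} {a c : P.Model}
    (h : (fderivModel P.arrowTgt z.fst a : EB) = fderivModel P.arrowSrc z.snd c) :
    (fderivModel (fun z : P.Composable => z.snd.fst) z (tangentPair z a c h) : EG) =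
      P.dfst z.snd c := by
  refine (fderivModel_comp (w := FiberProduct.fst) contMDiff_fst contMDiff_snd (fun _ => rfl) rfl
    _).symm.trans ?_
  rw [fderivModel_snd_tangentPair]; rfl

variable {P} in
theorem fderivModel_snd_snd {z : P.Composable} {a c : P.Model}
    (h : (fderivModel P.arrowTgt z.fst a : EB) = fderivModel P.arrowSrc z.snd c) :
    (fderivModel (fun z : P.Composable => z.snd.snd) z (tangentPair z a c h) : EH) =
      P.dsnd z.snd c := by
  refine (fderivModel_comp (w := FiberProduct.snd) contMDiff_snd contMDiff_snd (fun _ => rfl) rfl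
    _).symm.trans ?_
  rw [fderivModel_snd_tangentPair]; rfl

/-- The first component of `T mul (a, c)` is `T mul (a₁, T(▷) (a₂, c₁))`. -/
theorem dfst_fderivPair_arrowMul {z : P.Composable} {p : P.Arrow} (hp : P.arrowMul z = p)
    {a c : P.Model} (h : (fderivModel P.arrowTgt z.fst a : EB) = fderivModel P.arrowSrc z.snd c)
    {y : P.ActionPair} (hy : P.inner z = y)
    {x : FiberProduct 𝒢.tgt_submersion.contMDiff 𝒢.src_submersion}
    (hx₁ : z.fst.fst = x.fst) (hx₂ : P.lact y = x.snd)
    {a₁ : EG} {a₂ : EH} {c₁ : EG} (ha₁ : P.dfst z.fst a = a₁) (ha₂ : P.dsnd z.fst a = a₂)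
    (hc₁ : P.dfst z.snd c = c₁)
    (h₁ : (fderivModel ℋ.tgt y.fst a₂ : EB) = fderivModel 𝒢.src y.snd c₁)
    (h₂ : (fderivModel 𝒢.tgt x.fst a₁ : EB) =
      fderivModel 𝒢.src x.snd (fderivPair P.lact y a₂ c₁ h₁ : EG)) :
    P.dfst p (fderivPair P.arrowMul z a c h) = fderivPair 𝒢.mul x a₁ _ h₂ := by
  -- The first component of `arrowMul` is `mul ∘ A`, and the second entry of `A` is `lact ∘ inner`,
  -- so the chain rule is used twice. The points `y` and `x` may be simplified forms of `P.inner z`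
  -- and `A z`, obtained from the unit laws.
  let A : P.Composable → FiberProduct 𝒢.tgt_submersion.contMDiff 𝒢.src_submersion := fun z =>
    ⟨z.fst.fst, P.lact (P.inner z), by rw [P.src_lact]; exact z.fst.condition⟩
  have hA : ContMDiff 𝓘(ℝ, P.Model × P.arrowSrc_submersion.complement)
      𝓘(ℝ, EG × 𝒢.src_submersion.complement) ∞ A :=
    contMDiff_of_components P.fst_fst_smooth (P.lact_smooth.comp P.inner_smooth)
  have hAx : A z = x := FiberProduct.ext hx₁ ((congrArg P.lact hy).trans hx₂)
  refine (fderivModel_comp (w := FiberProduct.fst) contMDiff_fst P.arrowMul_smooth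
    (t := fun z => 𝒢.mul (A z)) (fun _ => rfl) hp _).trans ?_
  refine (fderivPair_eq 𝒢.mul_smooth hA (fun _ => rfl) hAx ((fderivModel_fst_fst h).trans ha₁) ?_
    h₂).symm
  exact (fderivPair_eq P.lact_smooth P.inner_smooth (fun _ => rfl) hy
    ((fderivModel_fst_snd h).trans ha₂) ((fderivModel_snd_fst h).trans hc₁) h₁).symm

/-- The second component of `T mul (a, c)` is `T mul (T(◁) (a₂, c₁), c₂)`. -/
theorem dsnd_fderivPair_arrowMul {z : P.Composable} {p : P.Arrow} (hp : P.arrowMul z = p)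
    {a c : P.Model} (h : (fderivModel P.arrowTgt z.fst a : EB) = fderivModel P.arrowSrc z.snd c)
    {y : P.ActionPair} (hy : P.inner z = y)
    {x : FiberProduct ℋ.tgt_submersion.contMDiff ℋ.src_submersion}
    (hx₁ : P.ract y = x.fst) (hx₂ : z.snd.snd = x.snd)
    {a₂ : EH} {c₁ : EG} {c₂ : EH} (ha₂ : P.dsnd z.fst a = a₂)
    (hc₁ : P.dfst z.snd c = c₁) (hc₂ : P.dsnd z.snd c = c₂)
    (h₁ : (fderivModel ℋ.tgt y.fst a₂ : EB) = fderivModel 𝒢.src y.snd c₁)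
    (h₂ : (fderivModel ℋ.tgt x.fst (fderivPair P.ract y a₂ c₁ h₁ : EH) : EB) =
      fderivModel ℋ.src x.snd c₂) :
    P.dsnd p (fderivPair P.arrowMul z a c h) = fderivPair ℋ.mul x _ c₂ h₂ := by
  -- Mirror image of the first component: the second component of `arrowMul` is `mul ∘ A`, and the
  -- action occupies the left entry.
  let A : P.Composable → FiberProduct ℋ.tgt_submersion.contMDiff ℋ.src_submersion := fun z =>
    ⟨P.ract (P.inner z), z.snd.snd, by rw [P.tgt_ract]; exact z.snd.condition⟩
  have hA : ContMDiff 𝓘(ℝ, P.Model × P.arrowSrc_submersion.complement)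
      𝓘(ℝ, EH × ℋ.src_submersion.complement) ∞ A :=
    contMDiff_of_components (P.ract_smooth.comp P.inner_smooth) P.snd_snd_smooth
  have hAx : A z = x := FiberProduct.ext ((congrArg P.ract hy).trans hx₁) hx₂
  refine (fderivModel_comp (w := FiberProduct.snd) contMDiff_snd P.arrowMul_smooth
    (t := fun z => ℋ.mul (A z)) (fun _ => rfl) hp _).trans ?_
  refine (fderivPair_eq ℋ.mul_smooth hA (fun _ => rfl) hAx ?_ ((fderivModel_snd_snd h).trans hc₂)
    h₂).symm
  exact (fderivPair_eq P.ract_smooth P.inner_smooth (fun _ => rfl) hy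
    ((fderivModel_fst_snd h).trans ha₂) ((fderivModel_snd_fst h).trans hc₁) h₁).symm

/-- Derivative of `α (h ▷ g) = α h`. For `a = T inv Y` and `c = 0` it computes `Tα Y†`. -/
theorem fderivModel_src_lact (y : P.ActionPair) (a : EH) (c : EG)
    (h : (fderivModel ℋ.tgt y.fst a : EB) = fderivModel 𝒢.src y.snd c) {g : G}
    (hg : P.lact y = g) :
    (fderivModel 𝒢.src g (fderivPair P.lact y a c h : EG) : EB) = fderivModel ℋ.src y.fst a := by
  refine (fderivModel_comp 𝒢.src_smooth P.lact_smooth P.src_lact hg _).trans ?_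
  refine (fderivModel_comp (w := ℋ.src) (u := FiberProduct.fst) ℋ.src_smooth contMDiff_fst
    (fun _ => rfl) rfl _).symm.trans ?_
  rw [fderivModel_fst_tangentPair]

/-- Derivative of `β (h ◁ g) = β g`. For `a = 0` and `c = X` it computes `Tβ X†`. -/
theorem fderivModel_tgt_ract (y : P.ActionPair) (a : EH) (c : EG)
    (h : (fderivModel ℋ.tgt y.fst a : EB) = fderivModel 𝒢.src y.snd c) {k : H}
    (hk : P.ract y = k) :
    (fderivModel ℋ.tgt k (fderivPair P.ract y a c h : EH) : EB) = fderivModel 𝒢.tgt y.snd c := by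
  refine (fderivModel_comp ℋ.tgt_smooth P.ract_smooth P.tgt_ract hk _).trans ?_
  refine (fderivModel_comp (w := 𝒢.tgt) (u := FiberProduct.snd) 𝒢.tgt_smooth contMDiff_snd
    (fun _ => rfl) rfl _).symm.trans ?_
  rw [fderivModel_snd_tangentPair]

theorem dfst_combine {b : B} (X : 𝒢.algFiber b) (Y : ℋ.algFiber b) :
    P.dfst (P.arrowUnit b) (P.groupoid.vec (P.combine X Y)) = 𝒢.vec X :=
  mfderiv_fst_tangentMk _ _ _ (mfderiv_src_combineSnd X Y)

theorem dsnd_combine {b : B} (X : 𝒢.algFiber b) (Y : ℋ.algFiber b) :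
    P.dsnd (P.arrowUnit b) (P.groupoid.vec (P.combine X Y)) =
      (fderivModel (ℋ.unit ∘ 𝒢.tgt) (𝒢.unit b) (𝒢.vec X) : EH) + ℋ.vec Y :=
  mfderiv_snd_tangentMk _ _ _ (mfderiv_src_combineSnd X Y)

/-! Infinitesimal actions as elements of the model space -/

def daggerXVec (h : H) {b : B} (hb : ℋ.tgt h = b) (X : 𝒢.algFiber b) : EH := P.daggerX h hb X

def daggerYVec (g : G) {b : B} (hb : 𝒢.src g = b) (Y : ℋ.algFiber b) : EG := P.daggerY g hb Y

/-! The left invariant field of `𝒢 ⋈ ℋ` -/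

/-- The first component `g (h ▷ g')` of the product does not involve `h'`, so only `X` enters. With
`g` and `h` fixed, the chain rule leaves `T mul (0, h ▷ X)`, based at `(g, ε(α h))` because `h ▷ ε(β
h) = ε(α h)`. -/
theorem dfst_leftVec (p : P.Arrow) {b : B} (hp : P.groupoid.tgt p = b) (X : 𝒢.algFiber b)
    (Y : ℋ.algFiber b) :
    P.dfst p (P.groupoid.leftVec p hp (P.combine X Y)) =
      𝒢.leftVec p.fst p.condition (P.lactAlg p.snd hp X) := by
  have e0 : ℋ.tgt p.snd = 𝒢.src (𝒢.unit b) := hp.trans (𝒢.src_unit b).symm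
  exact P.dfst_fderivPair_arrowMul (z := ⟨p, P.arrowUnit b, e0⟩) (P.groupoid.mul_unit' hp) _
    (y := ⟨p.snd, 𝒢.unit b, e0⟩) rfl
    (x := ⟨p.fst, 𝒢.unit (ℋ.src p.snd), by rw [𝒢.src_unit]; exact p.condition⟩) rfl
    (P.lact_unit hp) (map_zero _) (map_zero _) (P.dfst_combine X Y) _ _

/-- In `(h ◁ g') h'` both factors move, with velocities `X†(h)` and `T(ε ∘ β) X + Y`. The term `T(ε
∘ β) X` is exactly what the motion of the left factor requires for the product to stay defined, so
the right unit law applies. -/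
theorem dsnd_leftVec (p : P.Arrow) {b : B} (hp : P.groupoid.tgt p = b) (X : 𝒢.algFiber b)
    (Y : ℋ.algFiber b) :
    P.dsnd p (P.groupoid.leftVec p hp (P.combine X Y)) =
      P.daggerXVec p.snd hp X + ℋ.leftVec p.snd hp Y := by
  have e0 : ℋ.tgt p.snd = 𝒢.src (𝒢.unit b) := hp.trans (𝒢.src_unit b).symm
  have k0 : (fderivModel ℋ.tgt p.snd (0 : EH) : EB) =
      fderivModel 𝒢.src (𝒢.unit b) (𝒢.vec X) := by
    rw [map_zero, 𝒢.fderivModel_src_vec]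
  -- The inner `fderivPair` is `X†(h)`; its image under `T(ε ∘ β)` equals that of `X` because `Tβ X†
  -- = Tβ X`.
  have k1 : (fderivModel (ℋ.unit ∘ ℋ.tgt) p.snd
      (fderivPair P.ract ⟨p.snd, 𝒢.unit b, e0⟩ 0 (𝒢.vec X) k0 : EH) : EH) =
      fderivModel (ℋ.unit ∘ 𝒢.tgt) (𝒢.unit b) (𝒢.vec X) := by
    rw [← fderivModel_comp ℋ.unit_smooth ℋ.tgt_smooth (t := ℋ.unit ∘ ℋ.tgt) (fun _ => rfl) rfl,
      P.fderivModel_tgt_ract _ _ _ _ (P.ract_unit' hp),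
      ← fderivModel_comp ℋ.unit_smooth 𝒢.tgt_smooth (t := ℋ.unit ∘ 𝒢.tgt) (fun _ => rfl) rfl]
    rw [show ℋ.tgt p.snd = b from hp, 𝒢.tgt_unit]
  have k2 : (fderivModel ℋ.tgt p.snd
      (fderivPair P.ract ⟨p.snd, 𝒢.unit b, e0⟩ 0 (𝒢.vec X) k0 : EH) : EB) =
      fderivModel ℋ.src (ℋ.unit b)
        ((fderivModel (ℋ.unit ∘ 𝒢.tgt) (𝒢.unit b) (𝒢.vec X) : EH) + ℋ.vec Y) := by
    rw [P.fderivModel_tgt_ract _ _ _ _ (P.ract_unit' hp), map_add, ℋ.fderivModel_src_vec, add_zero,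
      fderivModel_comp ℋ.src_smooth (ℋ.unit_smooth.comp 𝒢.tgt_smooth)
        (fun _ => ℋ.src_unit _) (congrArg ℋ.unit (𝒢.tgt_unit b))]
  refine (P.dsnd_fderivPair_arrowMul (z := ⟨p, P.arrowUnit b, e0⟩) (P.groupoid.mul_unit' hp) _
    (y := ⟨p.snd, 𝒢.unit b, e0⟩) rfl
    (x := ⟨p.snd, ℋ.unit b, by rw [ℋ.src_unit]; exact hp⟩) (P.ract_unit' hp) rfl
    (map_zero _) (P.dfst_combine X Y) (P.dsnd_combine X Y) k0 k2).trans ?_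
  -- Replacing `T(ε ∘ β) X` by `T(ε ∘ β) X†(h)` brings the pair to the form `(u, T(ε ∘ β) u + Y)`
  -- with `u = X†(h)`.
  refine (fderivPair_congr ℋ.mul rfl rfl (congrArg (· + ℋ.vec Y) k1).symm _ ?_).trans
    (ℋ.fderivModel_mul_add_unit_tgt hp _ Y _)
  rw [k1]; exact k2

/-! The right invariant field of `𝒢 ⋈ ℋ` -/

/-- The section `x ↦ (x, ε (β x))` of the first projection. -/
def inclLeft (x : G) : P.Arrow := ⟨x, ℋ.unit (𝒢.tgt x), by rw [ℋ.src_unit]⟩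

/-- The section `y ↦ (ε (α y), y)` of the second projection. -/
def inclRight (y : H) : P.Arrow := ⟨𝒢.unit (ℋ.src y), y, by rw [𝒢.tgt_unit]⟩

theorem inclLeft_smooth : ContMDiff 𝓘(ℝ, EG) 𝓘(ℝ, P.Model) ∞ P.inclLeft :=
  contMDiff_of_components contMDiff_id (ℋ.unit_smooth.comp 𝒢.tgt_smooth)

theorem inclRight_smooth : ContMDiff 𝓘(ℝ, EH) 𝓘(ℝ, P.Model) ∞ P.inclRight :=
  contMDiff_of_components (𝒢.unit_smooth.comp ℋ.src_smooth) contMDiff_id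

theorem inclLeft_unit (b : B) : P.inclLeft (𝒢.unit b) = P.arrowUnit b :=
  FiberProduct.ext rfl (congrArg ℋ.unit (𝒢.tgt_unit b))

theorem inclRight_unit (b : B) : P.inclRight (ℋ.unit b) = P.arrowUnit b :=
  FiberProduct.ext (congrArg 𝒢.unit (ℋ.src_unit b)) rfl

/-- Writing `U` as a sum of images under tangent maps of globally defined smooth maps serves twice:
to compute `T inv U` and to see that `U` is smooth in `b`. The second summand has no `𝒢`-component,
since `T(ε ∘ α) Y = 0`. -/
theorem vec_combine {b : B} (X : 𝒢.algFiber b) (Y : ℋ.algFiber b) :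
    P.groupoid.vec (P.combine X Y) =
      (fderivModel P.inclLeft (𝒢.unit b) (𝒢.vec X) : P.Model) +
        fderivModel P.inclRight (ℋ.unit b) (ℋ.vec Y) := by
  apply tangent_ext_components (P.arrowUnit b)
  · refine (P.dfst_combine X Y).trans ?_
    rw [map_add, fderivModel_comp (w := FiberProduct.fst) FiberProduct.contMDiff_fst
      P.inclLeft_smooth (t := id) (fun _ => rfl) (P.inclLeft_unit b),
      fderivModel_comp (w := FiberProduct.fst) FiberProduct.contMDiff_fst
      P.inclRight_smooth (t := 𝒢.unit ∘ ℋ.src) (fun _ => rfl) (P.inclRight_unit b),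
      ← fderivModel_comp 𝒢.unit_smooth ℋ.src_smooth (t := 𝒢.unit ∘ ℋ.src) (fun _ => rfl) rfl,
      ℋ.fderivModel_src_vec, map_zero, add_zero]
    exact (fderivModel_of_eq_id (fun _ => rfl) _ _).symm
  · refine (P.dsnd_combine X Y).trans ?_
    rw [map_add, fderivModel_comp (w := FiberProduct.snd) FiberProduct.contMDiff_snd
      P.inclLeft_smooth (t := ℋ.unit ∘ 𝒢.tgt) (fun _ => rfl) (P.inclLeft_unit b),
      fderivModel_comp (w := FiberProduct.snd) FiberProduct.contMDiff_snd
      P.inclRight_smooth (t := id) (fun _ => rfl) (P.inclRight_unit b)]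
    exact congrArg _ (fderivModel_of_eq_id (fun _ => rfl) _ _).symm

/-- The inverse formula collapses here because the acting arrow of `ℋ` is a unit. -/
theorem arrowInv_inclLeft (x : G) : P.arrowInv (P.inclLeft x) =
    ⟨𝒢.inv x, ℋ.unit (𝒢.src x), by rw [𝒢.tgt_inv, ℋ.src_unit]⟩ := by
  have e : ℋ.tgt (ℋ.unit (𝒢.tgt x)) = 𝒢.src (𝒢.inv x) := by rw [ℋ.tgt_unit, 𝒢.src_inv]
  refine FiberProduct.ext ?_ ?_
  · exact (P.lact_congr (ℋ.inv_unit _) rfl (h' := e)).trans (P.unit_lact' (𝒢.src_inv x))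
  · refine (P.ract_congr (ℋ.inv_unit _) rfl (h' := e)).trans ((P.unit_ract (𝒢.src_inv x)).trans ?_)
    exact congrArg ℋ.unit (𝒢.tgt_inv x)

theorem arrowInv_inclRight (y : H) : P.arrowInv (P.inclRight y) =
    ⟨𝒢.unit (ℋ.tgt y), ℋ.inv y, by rw [𝒢.tgt_unit, ℋ.src_inv]⟩ := by
  have e : ℋ.tgt (ℋ.inv y) = 𝒢.src (𝒢.unit (ℋ.src y)) := by rw [𝒢.src_unit, ℋ.tgt_inv]
  refine FiberProduct.ext ?_ ?_
  · refine (P.lact_congr rfl (𝒢.inv_unit _) (h' := e)).trans ((P.lact_unit (ℋ.tgt_inv y)).trans ?_)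
    exact congrArg 𝒢.unit (ℋ.src_inv y)
  · exact (P.ract_congr rfl (𝒢.inv_unit _) (h' := e)).trans (P.ract_unit' (ℋ.tgt_inv y))

/-- By linearity of `T inv`, the inverse of `𝒢 ⋈ ℋ` need only be differentiated along the two
inclusions, where its formula involves no actions. -/
theorem invVec_combine {b : B} (X : 𝒢.algFiber b) (Y : ℋ.algFiber b) :
    P.groupoid.invVec (P.combine X Y) =
      (fderivModel (P.arrowInv ∘ P.inclLeft) (𝒢.unit b) (𝒢.vec X) : P.Model) +
        fderivModel (P.arrowInv ∘ P.inclRight) (ℋ.unit b) (ℋ.vec Y) := by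
  have h : P.groupoid.invVec (P.combine X Y) =
    fderivModel P.arrowInv (P.arrowUnit b) (P.groupoid.vec (P.combine X Y)) := rfl
  rw [h, P.vec_combine, map_add, fderivModel_comp P.arrowInv_smooth P.inclLeft_smooth
    (t := P.arrowInv ∘ P.inclLeft) (fun _ => rfl) (P.inclLeft_unit b),
    fderivModel_comp P.arrowInv_smooth P.inclRight_smooth
    (t := P.arrowInv ∘ P.inclRight) (fun _ => rfl) (P.inclRight_unit b)]

theorem dfst_invVec_combine {b : B} (X : 𝒢.algFiber b) (Y : ℋ.algFiber b) :
    P.dfst (P.arrowInv (P.arrowUnit b)) (P.groupoid.invVec (P.combine X Y)) =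
      𝒢.invVec X + (fderivModel (𝒢.unit ∘ ℋ.tgt) (ℋ.unit b) (ℋ.vec Y) : EG) := by
  rw [P.invVec_combine, map_add, dfst,
    fderivModel_comp FiberProduct.contMDiff_fst (P.arrowInv_smooth.comp P.inclLeft_smooth)
      (t := 𝒢.inv) (fun x => congrArg FiberProduct.fst (P.arrowInv_inclLeft x))
      (congrArg P.arrowInv (P.inclLeft_unit b)),
    fderivModel_comp FiberProduct.contMDiff_fst (P.arrowInv_smooth.comp P.inclRight_smooth)
      (t := 𝒢.unit ∘ ℋ.tgt) (fun x => congrArg FiberProduct.fst (P.arrowInv_inclRight x))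
      (congrArg P.arrowInv (P.inclRight_unit b))]
  rfl

/-- The contribution of `X` is `T(ε ∘ α) X = 0`. In the first component, by contrast, `Y`
contributes `T(ε ∘ β) Y`, which need not vanish. -/
theorem dsnd_invVec_combine {b : B} (X : 𝒢.algFiber b) (Y : ℋ.algFiber b) :
    P.dsnd (P.arrowInv (P.arrowUnit b)) (P.groupoid.invVec (P.combine X Y)) = ℋ.invVec Y := by
  rw [P.invVec_combine, map_add, dsnd,
    fderivModel_comp FiberProduct.contMDiff_snd (P.arrowInv_smooth.comp P.inclLeft_smooth)
      (t := ℋ.unit ∘ 𝒢.src) (fun x => congrArg FiberProduct.snd (P.arrowInv_inclLeft x))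
      (congrArg P.arrowInv (P.inclLeft_unit b)),
    fderivModel_comp FiberProduct.contMDiff_snd (P.arrowInv_smooth.comp P.inclRight_smooth)
      (t := ℋ.inv) (fun x => congrArg FiberProduct.snd (P.arrowInv_inclRight x))
      (congrArg P.arrowInv (P.inclRight_unit b)),
    ← fderivModel_comp ℋ.unit_smooth 𝒢.src_smooth (t := ℋ.unit ∘ 𝒢.src) (fun _ => rfl) rfl,
    𝒢.fderivModel_src_vec, map_zero, zero_add]
  rfl

/-- Before the sign of `→U` is applied, the component is `T mul (T inv X + T(ε ∘ β) Y, Y†)`, and the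
left unit law with `u = Y†` turns it into `-→X + Y†`. -/
theorem dfst_rightVec (q : P.Arrow) {b : B} (hq : P.groupoid.src q = b) (X : 𝒢.algFiber b)
    (Y : ℋ.algFiber b) :
    P.dfst q (P.groupoid.rightVec q hq (P.combine X Y)) =
      𝒢.rightVec q.fst hq X - P.daggerYVec q.fst hq Y := by
  have e0 : ℋ.tgt (ℋ.inv (ℋ.unit b)) = 𝒢.src q.fst := by rw [ℋ.tgt_inv, ℋ.src_unit]; exact hq.symm
  have e1 : P.arrowTgt (P.arrowInv (P.arrowUnit b)) = P.arrowSrc q :=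
    (P.groupoid.tgt_inv _).trans ((P.groupoid.src_unit b).trans hq.symm)
  have e2 : P.arrowInv (P.arrowUnit b) = P.arrowUnit b := P.groupoid.inv_unit b
  have hlact : P.lact ⟨ℋ.inv (ℋ.unit b), q.fst, e0⟩ = q.fst :=
    (P.lact_congr (ℋ.inv_unit b) rfl (h' := by rw [ℋ.tgt_unit]; exact hq.symm)).trans
      (P.unit_lact' hq)
  have k0 : (fderivModel ℋ.tgt (ℋ.inv (ℋ.unit b)) (ℋ.invVec Y) : EB) =
      fderivModel 𝒢.src q.fst (0 : EG) := by
    rw [map_zero, ℋ.fderivModel_tgt_invVec]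
  -- `Y†` is the derivative of `y_t⁻¹ ▷ g`, whose source is `α (y_t⁻¹) = β (y_t)`; hence `Tα Y† = Tβ
  -- Y`.
  have k1 : (fderivModel 𝒢.src q.fst (P.daggerYVec q.fst hq Y) : EB) =
      fderivModel ℋ.tgt (ℋ.unit b) (ℋ.vec Y) :=
    (P.fderivModel_src_lact _ _ _ k0 hlact).trans (ℋ.fderivModel_src_invVec Y)
  have k2 : (fderivModel (𝒢.unit ∘ 𝒢.src) q.fst (P.daggerYVec q.fst hq Y) : EG) =
      fderivModel (𝒢.unit ∘ ℋ.tgt) (ℋ.unit b) (ℋ.vec Y) := by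
    rw [← fderivModel_comp 𝒢.unit_smooth 𝒢.src_smooth (t := 𝒢.unit ∘ 𝒢.src) (fun _ => rfl)
      (show 𝒢.src q.fst = b from hq), k1,
      fderivModel_comp 𝒢.unit_smooth ℋ.tgt_smooth (t := 𝒢.unit ∘ ℋ.tgt) (fun _ => rfl)
        (ℋ.tgt_unit b)]
  have k3 : (fderivModel 𝒢.tgt (𝒢.inv (𝒢.unit b)) (𝒢.invVec X +
      (fderivModel (𝒢.unit ∘ ℋ.tgt) (ℋ.unit b) (ℋ.vec Y) : EG)) : EB) =
      fderivModel 𝒢.src q.fst (P.daggerYVec q.fst hq Y) := by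
    rw [map_add, 𝒢.fderivModel_tgt_invVec, zero_add, k1,
      fderivModel_comp 𝒢.tgt_smooth (𝒢.unit_smooth.comp ℋ.tgt_smooth) (fun _ => 𝒢.tgt_unit _)
        ((congrArg 𝒢.unit (ℋ.tgt_unit b)).trans (𝒢.inv_unit b).symm)]
  -- `→U` is based at the inverse of a unit, which equals the unit only propositionally; `e2` and
  -- `inv_unit` identify the base points.
  have key := P.dfst_fderivPair_arrowMul (z := ⟨P.arrowInv (P.arrowUnit b), q, e1⟩) (p := q)
    ((P.groupoid.mul_congr e2 rfl (h' := e2 ▸ e1)).trans (P.groupoid.unit_mul' hq))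
    ((P.groupoid.mfderiv_tgt_tangentInv (P.combine X Y)).trans (map_zero _).symm)
    (y := ⟨ℋ.inv (ℋ.unit b), q.fst, e0⟩)
    (FiberProduct.ext ((congrArg FiberProduct.snd e2).trans (ℋ.inv_unit b).symm) rfl)
    (x := ⟨𝒢.inv (𝒢.unit b), q.fst, by rw [𝒢.tgt_inv, 𝒢.src_unit]; exact hq.symm⟩)
    ((congrArg FiberProduct.fst e2).trans (𝒢.inv_unit b).symm) hlact
    (P.dfst_invVec_combine X Y) (P.dsnd_invVec_combine X Y) (map_zero _) k0 k3
  have key2 := 𝒢.fderivModel_mul_tangentInv_add (g := q.fst) hq X (P.daggerYVec q.fst hq Y)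
    (by rw [k2]; exact k3)
  refine (map_neg _ _).trans ((congrArg Neg.neg (key.trans ((fderivPair_congr 𝒢.mul rfl
    (congrArg (𝒢.invVec X + ·) k2).symm rfl _ _).trans key2))).trans ?_)
  abel

/-- The factor `h'` is fixed and the action sees only the `ℋ`-component `T inv Y` of `T inv U`, so
`X` does not appear. -/
theorem dsnd_rightVec (q : P.Arrow) {b : B} (hq : P.groupoid.src q = b) (X : 𝒢.algFiber b)
    (Y : ℋ.algFiber b) :
    P.dsnd q (P.groupoid.rightVec q hq (P.combine X Y)) =
      ℋ.rightVec q.snd q.condition.symm (P.ractAlg q.fst hq Y) := by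
  have e0 : ℋ.tgt (ℋ.inv (ℋ.unit b)) = 𝒢.src q.fst := by rw [ℋ.tgt_inv, ℋ.src_unit]; exact hq.symm
  have e1 : P.arrowTgt (P.arrowInv (P.arrowUnit b)) = P.arrowSrc q :=
    (P.groupoid.tgt_inv _).trans ((P.groupoid.src_unit b).trans hq.symm)
  have e2 : P.arrowInv (P.arrowUnit b) = P.arrowUnit b := P.groupoid.inv_unit b
  have hract : P.ract ⟨ℋ.inv (ℋ.unit b), q.fst, e0⟩ = ℋ.unit (𝒢.tgt q.fst) :=
    (P.ract_congr (ℋ.inv_unit b) rfl (h' := by rw [ℋ.tgt_unit]; exact hq.symm)).trans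
      (P.unit_ract hq)
  have k0 : (fderivModel ℋ.tgt (ℋ.inv (ℋ.unit b)) (ℋ.invVec Y) : EB) =
      fderivModel 𝒢.src q.fst (0 : EG) := by
    rw [map_zero, ℋ.fderivModel_tgt_invVec]
  -- `Y ◁ g` is the derivative of `(y_t⁻¹ ◁ g)⁻¹` and the right invariant field inverts once more;
  -- the two inversions cancel.
  have k1 : ℋ.invVec (P.ractAlg q.fst hq Y) =
      fderivPair P.ract ⟨ℋ.inv (ℋ.unit b), q.fst, e0⟩ (ℋ.invVec Y) 0 k0 :=
    ℋ.fderivModel_inv_inv ((congrArg ℋ.inv hract).trans (ℋ.inv_unit _)) _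
  have k2 := (ℋ.fderivModel_tgt_invVec (P.ractAlg q.fst hq Y)).trans
    (map_zero (fderivModel ℋ.src q.snd : EH →L[ℝ] EB)).symm
  have key := P.dsnd_fderivPair_arrowMul (z := ⟨P.arrowInv (P.arrowUnit b), q, e1⟩) (p := q)
    ((P.groupoid.mul_congr e2 rfl (h' := e2 ▸ e1)).trans (P.groupoid.unit_mul' hq))
    ((P.groupoid.mfderiv_tgt_tangentInv (P.combine X Y)).trans (map_zero _).symm)
    (y := ⟨ℋ.inv (ℋ.unit b), q.fst, e0⟩)
    (FiberProduct.ext ((congrArg FiberProduct.snd e2).trans (ℋ.inv_unit b).symm) rfl)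
    (x := ⟨ℋ.inv (ℋ.unit (𝒢.tgt q.fst)), q.snd, by
      rw [ℋ.tgt_inv, ℋ.src_unit]; exact q.condition⟩)
    (hract.trans (ℋ.inv_unit _).symm) rfl
    (P.dsnd_invVec_combine X Y) (map_zero _) (map_zero _) k0 (by rw [← k1]; exact k2)
  exact (map_neg _ _).trans (congrArg Neg.neg (key.trans
    (fderivPair_congr ℋ.mul rfl k1.symm rfl _ k2)))

/-! Sections of the Lie algebroid of `𝒢 ⋈ ℋ` -/

def combineSection (X : 𝒢.AlgSection) (Y : ℋ.AlgSection) : P.groupoid.AlgSection where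
  toFun b := P.combine (X b) (Y b)
  smooth := by
    have hX : SmoothAlong (EB := EB) 𝒢.unit (fun b => 𝒢.vec (X b)) := X.smooth
    have hY : SmoothAlong (EB := EB) ℋ.unit (fun b => ℋ.vec (Y b)) := Y.smooth
    -- This is the decomposition of `vec_combine`, in families over `B`.
    have h := (hX.map P.inclLeft_smooth P.inclLeft_unit).add_smul
      (hY.map P.inclRight_smooth P.inclRight_unit) 1
    refine Eq.mp (congrArg (SmoothAlong (EB := EB) P.arrowUnit) (funext fun b => ?_)) h
    rw [one_smul]
    exact (P.vec_combine (X b) (Y b)).symm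

/-- The component in `A_b 𝒢` of an element of `A_b (𝒢 ⋈ ℋ)`. -/
def algFst {b : B} (U : P.groupoid.algFiber b) : 𝒢.algFiber b :=
  ⟨P.dfst (P.arrowUnit b) (P.groupoid.vec U),
    (fderivModel_comp (w := 𝒢.src) (u := FiberProduct.fst) 𝒢.src_smooth
      FiberProduct.contMDiff_fst (t := P.arrowSrc) (fun _ => rfl) (x := P.arrowUnit b) rfl _).trans
      (P.groupoid.fderivModel_src_vec U)⟩

theorem vec_algFst {b : B} (U : P.groupoid.algFiber b) :
    𝒢.vec (P.algFst U) = P.dfst (P.arrowUnit b) (P.groupoid.vec U) := rfl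

/-- The `ℋ`-component `W - T(ε ∘ β) X` of the element `(X, W)` of `A_b (𝒢 ⋈ ℋ)`. -/
def algSndVec {b : B} (U : P.groupoid.algFiber b) : EH :=
  P.dsnd (P.arrowUnit b) (P.groupoid.vec U) +
    (-1 : ℝ) • (fderivModel (ℋ.unit ∘ 𝒢.tgt) (𝒢.unit b) (𝒢.vec (P.algFst U)) : EH)

/-- For `U = (X, W)`, differentiating `β g = α h` gives `Tα W = Tβ X`, and `α ∘ ε = id` gives `Tα
(T(ε ∘ β) X) = Tβ X`, so the two terms cancel. -/
theorem fderivModel_src_algSndVec {b : B} (U : P.groupoid.algFiber b) :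
    (fderivModel ℋ.src (ℋ.unit b) (P.algSndVec U) : EB) = 0 := by
  rw [algSndVec, map_add, map_smul, vec_algFst, dfst, dsnd,
    fderivModel_comp (w := ℋ.src) (u := FiberProduct.snd) ℋ.src_smooth
      FiberProduct.contMDiff_snd (t := fun p : P.Arrow => ℋ.src p.snd) (fun _ => rfl)
      (x := P.arrowUnit b) (x' := ℋ.unit b) rfl,
    fderivModel_comp ℋ.src_smooth (ℋ.unit_smooth.comp 𝒢.tgt_smooth) (t := 𝒢.tgt)
      (fun _ => ℋ.src_unit _) (congrArg ℋ.unit (𝒢.tgt_unit b)),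
    fderivModel_comp (w := 𝒢.tgt) (u := FiberProduct.fst) 𝒢.tgt_smooth
      FiberProduct.contMDiff_fst (t := fun p : P.Arrow => ℋ.src p.snd) (fun p => p.condition)
      (x := P.arrowUnit b) (x' := 𝒢.unit b) rfl]
  simp

def algSnd {b : B} (U : P.groupoid.algFiber b) : ℋ.algFiber b :=
  ⟨P.algSndVec U, P.fderivModel_src_algSndVec U⟩

/-- Surjectivity of `(X, Y) ↦ U`, the half of the correspondence needed to recover the equations for
every `U` from those for pairs. -/
theorem combine_algFst_algSnd {b : B} (U : P.groupoid.algFiber b) :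
    P.combine (P.algFst U) (P.algSnd U) = U := by
  refine Subtype.ext (tangent_ext_components (P.arrowUnit b)
    (P.dfst_combine (P.algFst U) (P.algSnd U)) ?_)
  refine (P.dsnd_combine (P.algFst U) (P.algSnd U)).trans ?_
  have h : ℋ.vec (P.algSnd U) = P.algSndVec U := rfl
  rw [h, algSndVec, neg_one_smul]
  exact add_neg_cancel_comm_assoc _ _

theorem smoothAlong_vec (U : P.groupoid.AlgSection) :
    SmoothAlong (EB := EB) P.arrowUnit (fun b => P.groupoid.vec (U b)) := U.smooth

def sectionFst (U : P.groupoid.AlgSection) : 𝒢.AlgSection where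
  toFun b := P.algFst (U b)
  smooth := (P.smoothAlong_vec U).map (u := FiberProduct.fst) FiberProduct.contMDiff_fst
    (fun _ => rfl)

def sectionSnd (U : P.groupoid.AlgSection) : ℋ.AlgSection where
  toFun b := P.algSnd (U b)
  smooth := by
    have h1 := (P.smoothAlong_vec U).map (u := FiberProduct.snd) FiberProduct.contMDiff_snd
      (τ := ℋ.unit) (fun _ => rfl)
    have hX : SmoothAlong (EB := EB) 𝒢.unit (fun b => 𝒢.vec (P.algFst (U b))) :=
      (P.sectionFst U).smooth
    -- The scalar `-1` matches the form in which `algSndVec` is written.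
    exact h1.add_smul (hX.map (ℋ.unit_smooth.comp 𝒢.tgt_smooth)
      (fun b => congrArg ℋ.unit (𝒢.tgt_unit b))) (-1)

/-! Local extensions -/

/-- The chart `φ` of `𝒢 ⋈ ℋ` at `p` is the restriction of a map `κ` given by the same formula on `𝒢
× ℋ`. Thus `φ⁻¹ ∘ κ` is a local retraction onto `𝒢 ⋈ ℋ`, and `L` is extended by composing with it.
Its values far from `p` are irrelevant. -/
theorem exists_isLocalExtension (L : P.Arrow → ℝ) (hL : ContMDiff 𝓘(ℝ, P.Model) 𝓘(ℝ, ℝ) ∞ L)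
    (p : P.Arrow) : ∃ Lt : G × H → ℝ, P.IsLocalExtension L p Lt := by
  have hc := IsManifold.chart_mem_maximalAtlas (I := 𝓘(ℝ, EG)) (n := ∞) p.fst
  have hφ := IsManifold.chart_mem_maximalAtlas (I := 𝓘(ℝ, P.Model)) (n := ∞) p
  have hs := mem_chart_source P.Model p
  let φ := chartAt P.Model p
  let κ : G × H → P.Model := coord ℋ.src_submersion (chartAt EG p.fst) p.snd
  have hκ : ∀ q : P.Arrow, κ q.incl = φ q := fun _ => rfl
  refine ⟨fun x => L (φ.symm (κ x)), ?_, ?_⟩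
  · have h1 : ContMDiffAt (𝓘(ℝ, EG).prod 𝓘(ℝ, EH)) 𝓘(ℝ, P.Model) ∞ κ p.incl :=
      (contMDiffOn_coord hc p.snd).contMDiffAt
        (((chartAt EG p.fst).open_source.preimage _root_.continuous_fst).inter
          ((dom ℋ.src_submersion p.snd).open_source.preimage _root_.continuous_snd) |>.mem_nhds
            ⟨mem_chart_source _ _, mem_dom _ _⟩)
    have h2 : ContMDiffAt 𝓘(ℝ, P.Model) 𝓘(ℝ, P.Model) ∞ φ.symm (κ p.incl) :=
      contMDiffAt_symm_of_mem_maximalAtlas hφ (φ.map_source hs)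
    exact (hL.contMDiffAt.comp (κ p.incl) h2).comp p.incl h1
  · filter_upwards [φ.open_source.mem_nhds hs] with q hq
    rw [hκ, φ.left_inv hq]

/-! ### Splitting the derivative of `L` and the Euler-Lagrange equations. -/

theorem deriv_eq_deriv₁_add_deriv₂ {L : P.Arrow → ℝ} {p : P.Arrow} {Lt : G × H → ℝ}
    (h : P.IsLocalExtension L p Lt) (V : P.Model) :
    P.groupoid.deriv L p V = P.deriv₁ Lt p (P.dfst p V) + P.deriv₂ Lt p (P.dsnd p V) := by
  have h1 : MDifferentiableAt (𝓘(ℝ, EG).prod 𝓘(ℝ, EH)) 𝓘(ℝ, ℝ) Lt p.incl :=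
    h.1.mdifferentiableAt (by simp)
  have h2 : MDifferentiableAt 𝓘(ℝ, P.Model) (𝓘(ℝ, EG).prod 𝓘(ℝ, EH))
      (incl : P.Arrow → G × H) p := contMDiff_incl.contMDiffAt.mdifferentiableAt (by simp)
  have h3 : L =ᶠ[𝓝 p] Lt ∘ incl := h.2.mono fun q hq => hq.symm
  let D : EG × EH →L[ℝ] ℝ := mfderiv (𝓘(ℝ, EG).prod 𝓘(ℝ, EH)) 𝓘(ℝ, ℝ) Lt p.incl
  have h4 : P.groupoid.deriv L p V = D (P.dfst p V, P.dsnd p V) := by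
    refine (congrArg (fun T : P.Model →L[ℝ] ℝ => T V)
      (h3.mfderiv_eq.trans (mfderiv_comp p h1 h2))).trans ?_
    exact congrArg D (mfderiv_incl_apply p V)
  -- The two summands are in general not tangent to `𝒢 ⋈ ℋ`, which is why an extension of `L` is
  -- needed to speak of the separate derivatives.
  have h5 : (P.dfst p V, P.dsnd p V) = (P.dfst p V, (0 : EH)) + ((0 : EG), P.dsnd p V) := by
    simp
  rw [h4, h5, map_add]
  rfl

theorem deriv_sub_deriv_combine {L : P.Arrow → ℝ} {p q : P.Arrow} {Lp Lq : G × H → ℝ}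
    (hLp : P.IsLocalExtension L p Lp) (hLq : P.IsLocalExtension L q Lq) {b : B}
    (hp : P.groupoid.tgt p = b) (hq : P.groupoid.src q = b) (X : 𝒢.algFiber b)
    (Y : ℋ.algFiber b) :
    P.groupoid.deriv L p (P.groupoid.leftInv p hp (P.combine X Y)) -
      P.groupoid.deriv L q (P.groupoid.rightInv q hq (P.combine X Y)) =
    P.splitExpr Lp Lq p q hp hq X Y := by
  have e1 := P.deriv_eq_deriv₁_add_deriv₂ hLp (P.groupoid.leftVec p hp (P.combine X Y))
  have e2 := P.deriv_eq_deriv₁_add_deriv₂ hLq (P.groupoid.rightVec q hq (P.combine X Y))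
  rw [dfst_leftVec, dsnd_leftVec] at e1
  rw [dfst_rightVec, dsnd_rightVec] at e2
  let Dp : EG × EH →L[ℝ] ℝ := mfderiv (𝓘(ℝ, EG).prod 𝓘(ℝ, EH)) 𝓘(ℝ, ℝ) Lp p.incl
  let Dq : EG × EH →L[ℝ] ℝ := mfderiv (𝓘(ℝ, EG).prod 𝓘(ℝ, EH)) 𝓘(ℝ, ℝ) Lq q.incl
  -- Only the components `X† + ←Y` at `p` and `→X - Y†` at `q` are composite, so additivity is
  -- needed for these two partial derivatives alone.
  have a1 : ∀ v w : EH, P.deriv₂ Lp p (v + w : EH) = P.deriv₂ Lp p v + P.deriv₂ Lp p w :=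
    fun v w => (Dp.comp (ContinuousLinearMap.inr ℝ EG EH)).map_add v w
  have a2 : ∀ v w : EG, P.deriv₁ Lq q (v - w : EG) = P.deriv₁ Lq q v - P.deriv₁ Lq q w :=
    fun v w => (Dq.comp (ContinuousLinearMap.inl ℝ EG EH)).map_sub v w
  rw [a1] at e1
  rw [a2] at e2
  refine (congrArg₂ (· - ·) e1 e2).trans ?_
  simp only [splitExpr, leftVec, rightVec, daggerXVec, daggerYVec]
  ring

theorem discreteEulerLagrange_iff {L : P.Arrow → ℝ} {p q : P.Arrow}
    (hpq : P.groupoid.tgt p = P.groupoid.src q) :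
    P.groupoid.DiscreteEulerLagrange L p q ↔ ∀ (X : 𝒢.AlgSection) (Y : ℋ.AlgSection),
      P.groupoid.deriv L p (P.groupoid.leftInv p rfl
          (P.combine (X (P.groupoid.tgt p)) (Y (P.groupoid.tgt p)))) -
        P.groupoid.deriv L q (P.groupoid.rightInv q hpq.symm
          (P.combine (X (P.groupoid.tgt p)) (Y (P.groupoid.tgt p)))) = 0 := by
  -- The definition evaluates the section at `β p` for the left field and at `α q` for the right
  -- one; both values are moved to the same base point.
  have h : ∀ (U : P.groupoid.AlgSection) (b : B) (hq : P.groupoid.src q = b),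
      P.groupoid.rightInv q rfl (U (P.groupoid.src q)) = P.groupoid.rightInv q hq (U b) := by
    rintro U _ rfl; rfl
  constructor
  · intro hE X Y
    have := hE.2 (P.combineSection X Y)
    rwa [h _ _ hpq.symm] at this
  · refine fun hE => ⟨hpq, fun U => ?_⟩
    -- Every section `U` is the combination of its two smooth component sections.
    have := hE (P.sectionFst U) (P.sectionSnd U)
    rw [h _ _ hpq.symm]
    rw [← P.combine_algFst_algSnd (U (P.groupoid.tgt p))]
    exact this

end MatchedPair

end

/-! ### The proposition. -/

theorem mainTheorem1 {EB B EG G EH H : Type*}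
    [NormedAddCommGroup EB] [NormedSpace ℝ EB] [NormedAddCommGroup EG] [NormedSpace ℝ EG]
    [NormedAddCommGroup EH] [NormedSpace ℝ EH]
    [TopologicalSpace B] [ChartedSpace EB B] [IsManifold 𝓘(ℝ, EB) ∞ B]
    [TopologicalSpace G] [ChartedSpace EG G] [IsManifold 𝓘(ℝ, EG) ∞ G]
    [TopologicalSpace H] [ChartedSpace EH H] [IsManifold 𝓘(ℝ, EH) ∞ H]
    {𝒢 : LieGroupoid EB B EG G} {ℋ : LieGroupoid EB B EH H} (P : MatchedPair 𝒢 ℋ)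
    (L : P.Arrow → ℝ) (hL : ContMDiff 𝓘(ℝ, P.Model) 𝓘(ℝ, ℝ) ∞ L)
    (p q : P.Arrow) (hpq : P.groupoid.tgt p = P.groupoid.src q) :
    (∃ Lp : G × H → ℝ, P.IsLocalExtension L p Lp) ∧
    (∃ Lq : G × H → ℝ, P.IsLocalExtension L q Lq) ∧
    ∀ Lp Lq : G × H → ℝ, P.IsLocalExtension L p Lp → P.IsLocalExtension L q Lq →
      (∀ (b : B) (hp : P.groupoid.tgt p = b) (hq : P.groupoid.src q = b)
        (X : 𝒢.algFiber b) (Y : ℋ.algFiber b),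
        P.groupoid.deriv L p (P.groupoid.leftInv p hp (P.combine X Y)) -
          P.groupoid.deriv L q (P.groupoid.rightInv q hq (P.combine X Y)) =
        P.splitExpr Lp Lq p q hp hq X Y) ∧
      (P.groupoid.DiscreteEulerLagrange L p q ↔
        ∀ (X : 𝒢.AlgSection) (Y : ℋ.AlgSection),
          P.splitExpr Lp Lq p q rfl hpq.symm (X (ℋ.tgt p.snd)) (Y (ℋ.tgt p.snd)) = 0) := by
  refine ⟨P.exists_isLocalExtension L hL p, P.exists_isLocalExtension L hL q,
    fun Lp Lq hLp hLq => ⟨fun b hp hq X Y => P.deriv_sub_deriv_combine hLp hLq hp hq X Y, ?_⟩⟩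
  refine (P.discreteEulerLagrange_iff hpq).trans (forall₂_congr fun X Y => ?_)
  -- The first claim at `b = β h_k` turns each equation for the combined section into the vanishing
  -- of `splitExpr`.
  exact (P.deriv_sub_deriv_combine hLp hLq rfl hpq.symm _ _).congr_left
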